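/- **Definitions.** A *BI algebra* is a Heyting algebra $A$ with binary operations $*, \mathbin{-\!*}$ and a constant $I$ such that $(A,*,I)$ is a commutative monoid and $a*b\le c \iff a\le b\mathbin{-\!*}c \iff b\le a\mathbin{-\!*}c$; it is a *BBI algebra* if the Heyting algebra is Boolean. Morphisms are homomorphisms for all operations. (The one-element algebra and the empty space below are allowed.) Let $X$ be a set with a preorder $\preccurlyeq$, a map $\circ:X^2\to\mathcal P(X)$ and $E\subseteq X$. For $A,B\subseteq X$ put - $A\bullet B=\{x\mid \exists w,y,z:\ w\preccurlyeq x,\ w\in y\circ z,\ y\in A,\ z\in B\}$, - $A\Rightarrow B=\{x\mid \forall y\succcurlyeq x:\ y\in A\to y\in B\}$, - $A\mathbin{-\!\bullet}B=\{x\mid\forall w,y,z:\ x\preccurlyeq w,\ z\in w\circ y,\ y\in A\ \to\ z\in B\}$, - $A\mathbin{\bullet\!-}B=\{x\mid\forall w,y,z:\ x\preccurlyeq w,\ z\in y\circ w,\ y\in A\ \to\ z\in B\}$. $(X,\preccurlyeq,\circ,E)$ is a *BI frame* if for all elements: $z\in x\circ y\to z\in y\circ x$; $e\in E\wedge e\preccurlyeq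 e'\to e'\in E$; $\exists e\in E\,(x\in x\circ e)$; $e\in E\wedge x\in y\circ e\to y\preccurlyeq x$; and $t\preccurlyeq t'\wedge t\in x\circ y\wedge w\in t'\circ z\to\exists s,s',w'\,(s\preccurlyeq s'\wedge s\in y\circ z\wedge w'\preccurlyeq w\wedge w'\in x\circ s')$. A *BI morphism* is a map $g:X\to X'$ with: (1) $x\preccurlyeq y\to g(x)\preccurlyeq' g(y)$; (2) $g(x)\preccurlyeq' y'\to\exists y\succcurlyeq x$, $g(y)=y'$; (3) $x\in y\circ z\to g(x)\in g(y)\circ' g(z)$; (4) $w'\preccurlyeq' g(x)$, $w'\in y'\circ' z'$ $\to$ $\exists w,y,z$: $w\preccurlyeq x$, $w\in y\circ z$, $y'\preccurlyeq' g(y)$, $z'\preccurlyeq' g(z)$; (5) $g(x)\preccurlyeq' w'$, $z'\in w'\circ' y'$ $\to$ $\exists w,y,z$: $x\preccurlyeq w$, $z\in w\circ y$, $y'\preccurlyeq' g(y)$, $g(z)\preccurlyeq' z'$; (6) the same with $z'\in y'\circ' w'$ and $z\in y\circ w$; (7) $e\in E\iff g(e)\in E'$. A *BI space* is a BI frame $(X,\preccurlyeq,\circ,E)$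 with a topology such that: $(X,\preccurlyeq)$ is an Esakia space (a compact partially ordered space in which $x\not\preccurlyeq y$ implies that some clopen up-set contains $x$ and not $y$, and in which the down-closure of each clopen set is clopen); the clopen up-sets are closed under $\bullet$, $\mathbin{-\!\bullet}$, $\mathbin{\bullet\!-}$; whenever $x\notin y\circ z$ there are clopen up-sets $C_1\ni y$, $C_2\ni z$ with $x\notin C_1\bullet C_2$; and $E$ is clopen. Morphisms are continuous BI morphisms. *BBI frames*, *BBI morphisms* and *BBI spaces* are defined in the same way with $\preccurlyeq$ replaced by equality, "Esakia space" by "Stone space" (compact, Hausdorff, totally disconnected) and "clopen up-set" by "clopen set". For a BI or BBI algebra $A$ let $Pr(A)$ be the set of its (proper) prime filters with $F\circ G=\{H\mid \forall a\in F\,\forall b\in G:\ a*b\in H\}$ and $E=\{F\mid I\in F\}$, and let $\theta_A(a)=\{F\in Pr(A)\mid a\in F\}$. In the BI case $Pr(A)$ is ordered by inclusion and has the topology with subbase all $\theta_A(a)$ and their complements; in the BBI case it has the topology generated by all $\theta_A(a)$. For a BI (BBI) space $X$ let $Clop(X)$ be the algebra of its clopen up-sets (clopen sets) with $\cap,\cup,\Rightarrow,X,\emptyset,\bullet,\mathbin{-\!\bullet},E$,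 and let $\eta_X(x)=\{C\in Clop(X)\mid x\in C\}$. Put $Pr(f)=f^{-1}$ and $Clop(g)=g^{-1}$ on morphisms. **Theorem (Duality Theorem for (B)BI).** $Pr:\mathrm{BIAlg}\to\mathrm{BISp}^{op}$ and $Clop:\mathrm{BISp}^{op}\to\mathrm{BIAlg}$ are well-defined functors, and $\theta:\mathrm{Id}\to Clop\,Pr$ and $\eta:\mathrm{Id}\to Pr\,Clop$ are natural isomorphisms satisfying $Pr(\theta_A)\circ\eta_{Pr(A)}=\mathrm{id}_{Pr(A)}$; that is, $\theta$ and $\eta$ form a dual (adjoint) equivalence of categories between BI algebras and BI spaces. The same holds for BBI algebras and BBI spaces. -/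

import Mathlib

open CategoryTheory Opposite TopologicalSpace

universe u

namespace BunchedDuality

/-! ## Algebras -/

/-- The bunched structure on a Heyting algebra that makes it a BI algebra: a commutative monoid
operation `star` with unit `emp`, and its residual `wand`. Both residuation laws are recorded
(the underlying layered algebra is taken with its two residuals equal). -/
class BIStructure (A : Type u) [HeytingAlgebra A] where
  star : A → A → A
  wand : A → A → A
  emp : A
  star_comm : ∀ a b, star a b = star b a
  star_assoc : ∀ a b c, star (star a b) c = star a (star b c)
  star_emp : ∀ a, star a emp = a
  star_le_iff : ∀ a b c, star a b ≤ c ↔ a ≤ wand b c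
  star_le_iff' : ∀ a b c, star a b ≤ c ↔ b ≤ wand a c

open BIStructure

/-- Homomorphisms: maps preserving the Heyting operations and the bunched operations. Between
Boolean algebras these are the Boolean homomorphisms preserving the bunched operations. -/
structure BIHom (A B : Type u) [HeytingAlgebra A] [HeytingAlgebra B]
    [BIStructure A] [BIStructure B] extends HeytingHom A B where
  map_star' : ∀ a b, toFun (star a b) = star (toFun a) (toFun b)
  map_wand' : ∀ a b, toFun (wand a b) = wand (toFun a) (toFun b)
  map_emp' : toFun emp = emp

namespace BIHom

variable {A B C : Type u} [HeytingAlgebra A] [HeytingAlgebra B] [HeytingAlgebra C]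
  [BIStructure A] [BIStructure B] [BIStructure C]

instance : FunLike (BIHom A B) A B where
  coe f := f.toHeytingHom
  coe_injective := by
    rintro ⟨f, _, _, _⟩ ⟨g, _, _, _⟩ h
    have : f = g := DFunLike.coe_injective h
    subst this
    rfl

@[ext] theorem ext {f g : BIHom A B} (h : ∀ a, f a = g a) : f = g := DFunLike.ext f g h

/-- The identity homomorphism. -/
def id (A : Type u) [HeytingAlgebra A] [BIStructure A] : BIHom A A where
  toHeytingHom := HeytingHom.id A
  map_star' _ _ := rfl
  map_wand' _ _ := rfl
  map_emp' := rfl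

/-- Composition of homomorphisms: first `f`, then `g`. -/
def comp (g : BIHom B C) (f : BIHom A B) : BIHom A C where
  toHeytingHom := g.toHeytingHom.comp f.toHeytingHom
  map_star' a b := (congrArg g (f.map_star' a b)).trans (g.map_star' _ _)
  map_wand' a b := (congrArg g (f.map_wand' a b)).trans (g.map_wand' _ _)
  map_emp' := (congrArg g f.map_emp').trans g.map_emp'

end BIHom

/-- BI algebras. -/
structure BIAlg : Type (u + 1) where
  carrier : Type u
  [heyting : HeytingAlgebra carrier]
  [bi : BIStructure carrier]

attribute [instance] BIAlg.heyting BIAlg.bi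

instance : CoeSort BIAlg.{u} (Type u) := ⟨BIAlg.carrier⟩

instance : Category BIAlg.{u} where
  Hom A B := BIHom A B
  id A := BIHom.id A
  comp f g := BIHom.comp g f

instance : ConcreteCategory BIAlg.{u} (fun A B => BIHom A B) where
  hom f := f
  ofHom f := f

/-- BBI algebras: BI algebras whose underlying Heyting algebra is a Boolean algebra. -/
structure BBIAlg : Type (u + 1) where
  carrier : Type u
  [boolean : BooleanAlgebra carrier]
  [bi : BIStructure carrier]

attribute [instance] BBIAlg.boolean BBIAlg.bi

instance : CoeSort BBIAlg.{u} (Type u) := ⟨BBIAlg.carrier⟩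

instance : Category BBIAlg.{u} where
  Hom A B := BIHom A B
  id A := BIHom.id A
  comp f g := BIHom.comp g f

instance : ConcreteCategory BBIAlg.{u} (fun A B => BIHom A B) where
  hom f := f
  ofHom f := f

/-! ## Frames

A composition on `X` is a map `c : X → X → Set X`; `E : Set X` is the set of units. -/

section Ordered

variable {X Y Z : Type u}

/-- `A • B` in the ordered case. -/
def upStar [Preorder X] (c : X → X → Set X) (A B : Set X) : Set X :=
  {x | ∃ w y z, w ≤ x ∧ w ∈ c y z ∧ y ∈ A ∧ z ∈ B}

/-- The residual of `•` in the ordered case, composing with the argument on the right. -/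
def upWand [Preorder X] (c : X → X → Set X) (A B : Set X) : Set X :=
  {x | ∀ w y z, x ≤ w → z ∈ c w y → y ∈ A → z ∈ B}

/-- The residual of `•` in the ordered case, composing with the argument on the left. -/
def upDnaw [Preorder X] (c : X → X → Set X) (A B : Set X) : Set X :=
  {x | ∀ w y z, x ≤ w → z ∈ c y w → y ∈ A → z ∈ B}

/-- Heyting implication of upwards-closed sets. -/
def upImp [Preorder X] (A B : Set X) : Set X :=
  {x | ∀ y, x ≤ y → y ∈ A → y ∈ B}

/-- BI frames. -/
structure IsBIFrame [Preorder X] (c : X → X → Set X) (E : Set X) : Prop where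
  comm : ∀ x y z, z ∈ c x y → z ∈ c y x
  closure : ∀ e e', e ∈ E → e ≤ e' → e' ∈ E
  unit_exists : ∀ x, ∃ e ∈ E, x ∈ c x e
  coherence : ∀ x y e, e ∈ E → x ∈ c y e → y ≤ x
  assoc : ∀ x y z t t' w, t ≤ t' → t ∈ c x y → w ∈ c t' z →
    ∃ s s' w', s ≤ s' ∧ s ∈ c y z ∧ w' ≤ w ∧ w' ∈ c x s'

/-- ILGL morphisms. -/
structure IsILGLMorphism [Preorder X] [Preorder Y] (c : X → X → Set X) (d : Y → Y → Set Y)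
    (g : X → Y) : Prop where
  mono : ∀ x y, x ≤ y → g x ≤ g y
  back_le : ∀ x y', g x ≤ y' → ∃ y, x ≤ y ∧ g y = y'
  forth : ∀ x y z, x ∈ c y z → g x ∈ d (g y) (g z)
  back_star : ∀ x w' y' z', w' ≤ g x → w' ∈ d y' z' →
    ∃ w y z, w ≤ x ∧ w ∈ c y z ∧ y' ≤ g y ∧ z' ≤ g z
  back_wand : ∀ x w' y' z', g x ≤ w' → z' ∈ d w' y' →
    ∃ w y z, x ≤ w ∧ z ∈ c w y ∧ y' ≤ g y ∧ g z ≤ z'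
  back_dnaw : ∀ x w' y' z', g x ≤ w' → z' ∈ d y' w' →
    ∃ w y z, x ≤ w ∧ z ∈ c y w ∧ y' ≤ g y ∧ g z ≤ z'

/-- BI morphisms. -/
structure IsBIMorphism [Preorder X] [Preorder Y] (c : X → X → Set X) (E : Set X)
    (d : Y → Y → Set Y) (E' : Set Y) (g : X → Y) : Prop extends IsILGLMorphism c d g where
  unit_iff : ∀ e, e ∈ E ↔ g e ∈ E'

theorem IsBIMorphism.id [Preorder X] (c : X → X → Set X) (E : Set X) :
    IsBIMorphism c E c E (fun x => x) where
  mono _ _ h := h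
  back_le _ y' h := ⟨y', h, rfl⟩
  forth _ _ _ h := h
  back_star _ w y z h h' := ⟨w, y, z, h, h', le_rfl, le_rfl⟩
  back_wand _ w y z h h' := ⟨w, y, z, h, h', le_rfl, le_rfl⟩
  back_dnaw _ w y z h h' := ⟨w, y, z, h, h', le_rfl, le_rfl⟩
  unit_iff _ := Iff.rfl

theorem IsBIMorphism.comp [Preorder X] [Preorder Y] [Preorder Z]
    {c : X → X → Set X} {E : Set X} {d : Y → Y → Set Y} {E' : Set Y}
    {k : Z → Z → Set Z} {E'' : Set Z} {g : X → Y} {h : Y → Z}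
    (hh : IsBIMorphism d E' k E'' h) (hg : IsBIMorphism c E d E' g) :
    IsBIMorphism c E k E'' (fun x => h (g x)) where
  mono x y l := hh.mono _ _ (hg.mono x y l)
  back_le x y' l := by
    obtain ⟨y, h1, rfl⟩ := hh.back_le _ _ l
    obtain ⟨z, h2, rfl⟩ := hg.back_le _ _ h1
    exact ⟨z, h2, rfl⟩
  forth x y z l := hh.forth _ _ _ (hg.forth x y z l)
  back_star x w' y' z' l m := by
    obtain ⟨w, y, z, a1, a2, a3, a4⟩ := hh.back_star _ _ _ _ l m
    obtain ⟨w1, y1, z1, b1, b2, b3, b4⟩ := hg.back_star _ _ _ _ a1 a2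
    exact ⟨w1, y1, z1, b1, b2, a3.trans (hh.mono _ _ b3), a4.trans (hh.mono _ _ b4)⟩
  back_wand x w' y' z' l m := by
    obtain ⟨w, y, z, a1, a2, a3, a4⟩ := hh.back_wand _ _ _ _ l m
    obtain ⟨w1, y1, z1, b1, b2, b3, b4⟩ := hg.back_wand _ _ _ _ a1 a2
    exact ⟨w1, y1, z1, b1, b2, a3.trans (hh.mono _ _ b3), (hh.mono _ _ b4).trans a4⟩
  back_dnaw x w' y' z' l m := by
    obtain ⟨w, y, z, a1, a2, a3, a4⟩ := hh.back_dnaw _ _ _ _ l m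
    obtain ⟨w1, y1, z1, b1, b2, b3, b4⟩ := hg.back_dnaw _ _ _ _ a1 a2
    exact ⟨w1, y1, z1, b1, b2, a3.trans (hh.mono _ _ b3), (hh.mono _ _ b4).trans a4⟩
  unit_iff e := (hg.unit_iff e).trans (hh.unit_iff _)

end Ordered

section Discrete

variable {X Y Z : Type u}

/-- `A • B` in the classical (unordered) case. -/
def clStar (c : X → X → Set X) (A B : Set X) : Set X :=
  {x | ∃ y z, y ∈ A ∧ z ∈ B ∧ x ∈ c y z}

/-- The residual of `•` in the classical case, composing with the argument on the right. -/
def clWand (c : X → X → Set X) (A B : Set X) : Set X :=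
  {x | ∀ y z, z ∈ c x y → y ∈ A → z ∈ B}

/-- The residual of `•` in the classical case, composing with the argument on the left. -/
def clDnaw (c : X → X → Set X) (A B : Set X) : Set X :=
  {x | ∀ y z, z ∈ c y x → y ∈ A → z ∈ B}

/-- BBI frames. -/
structure IsBBIFrame (c : X → X → Set X) (E : Set X) : Prop where
  comm : ∀ x y z, z ∈ c x y → z ∈ c y x
  unit_exists : ∀ x, ∃ e ∈ E, x ∈ c x e
  coherence : ∀ x y e, x ∈ c y e → e ∈ E → y = x
  assoc : ∀ x y z t w, t ∈ c x y → w ∈ c t z → ∃ s, s ∈ c y z ∧ w ∈ c x s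

/-- LGL morphisms. -/
structure IsLGLMorphism (c : X → X → Set X) (d : Y → Y → Set Y) (g : X → Y) : Prop where
  forth : ∀ x y z, x ∈ c y z → g x ∈ d (g y) (g z)
  back_star : ∀ x y' z', g x ∈ d y' z' → ∃ y z, x ∈ c y z ∧ g y = y' ∧ g z = z'
  back_wand : ∀ x y' z', z' ∈ d (g x) y' → ∃ y z, z ∈ c x y ∧ g y = y' ∧ g z = z'
  back_dnaw : ∀ x y' z', z' ∈ d y' (g x) → ∃ y z, z ∈ c y x ∧ g y = y' ∧ g z = z'

/-- BBI morphisms. -/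
structure IsBBIMorphism (c : X → X → Set X) (E : Set X) (d : Y → Y → Set Y) (E' : Set Y)
    (g : X → Y) : Prop extends IsLGLMorphism c d g where
  unit_iff : ∀ e, e ∈ E ↔ g e ∈ E'

theorem IsBBIMorphism.id (c : X → X → Set X) (E : Set X) :
    IsBBIMorphism c E c E (fun x => x) where
  forth _ _ _ h := h
  back_star _ y z h := ⟨y, z, h, rfl, rfl⟩
  back_wand _ y z h := ⟨y, z, h, rfl, rfl⟩
  back_dnaw _ y z h := ⟨y, z, h, rfl, rfl⟩
  unit_iff _ := Iff.rfl

theorem IsBBIMorphism.comp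
    {c : X → X → Set X} {E : Set X} {d : Y → Y → Set Y} {E' : Set Y}
    {k : Z → Z → Set Z} {E'' : Set Z} {g : X → Y} {h : Y → Z}
    (hh : IsBBIMorphism d E' k E'' h) (hg : IsBBIMorphism c E d E' g) :
    IsBBIMorphism c E k E'' (fun x => h (g x)) where
  forth x y z l := hh.forth _ _ _ (hg.forth x y z l)
  back_star x y' z' m := by
    obtain ⟨y, z, a, rfl, rfl⟩ := hh.back_star _ _ _ m
    obtain ⟨y1, z1, b, rfl, rfl⟩ := hg.back_star _ _ _ a
    exact ⟨y1, z1, b, rfl, rfl⟩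
  back_wand x y' z' m := by
    obtain ⟨y, z, a, rfl, rfl⟩ := hh.back_wand _ _ _ m
    obtain ⟨y1, z1, b, rfl, rfl⟩ := hg.back_wand _ _ _ a
    exact ⟨y1, z1, b, rfl, rfl⟩
  back_dnaw x y' z' m := by
    obtain ⟨y, z, a, rfl, rfl⟩ := hh.back_dnaw _ _ _ m
    obtain ⟨y1, z1, b, rfl, rfl⟩ := hg.back_dnaw _ _ _ a
    exact ⟨y1, z1, b, rfl, rfl⟩
  unit_iff e := (hg.unit_iff e).trans (hh.unit_iff _)

end Discrete

/-! ## Spaces -/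

/-- Esakia spaces: compact ordered spaces satisfying the Priestley separation axiom, in which the
downward closure of a clopen set is clopen. -/
structure IsEsakiaSpace (X : Type u) [TopologicalSpace X] [PartialOrder X] : Prop where
  compact : CompactSpace X
  priestley : PriestleySpace X
  lower_clopen : ∀ U : Set X, IsClopen U → IsClopen (lowerClosure U : Set X)

/-- Stone spaces. -/
structure IsStoneSpace (X : Type u) [TopologicalSpace X] : Prop where
  compact : CompactSpace X
  hausdorff : T2Space X
  totallyDisconnected : TotallyDisconnectedSpace X

/-- ILGL spaces. -/
structure IsILGLSpace {X : Type u} [TopologicalSpace X] [PartialOrder X]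
    (c : X → X → Set X) : Prop where
  esakia : IsEsakiaSpace X
  star_clopen : ∀ A B : ClopenUpperSet X,
    IsClopen (upStar c (A : Set X) B) ∧ IsUpperSet (upStar c (A : Set X) B)
  wand_clopen : ∀ A B : ClopenUpperSet X,
    IsClopen (upWand c (A : Set X) B) ∧ IsUpperSet (upWand c (A : Set X) B)
  dnaw_clopen : ∀ A B : ClopenUpperSet X,
    IsClopen (upDnaw c (A : Set X) B) ∧ IsUpperSet (upDnaw c (A : Set X) B)
  separation : ∀ x y z, x ∉ c y z →
    ∃ A B : ClopenUpperSet X, y ∈ A ∧ z ∈ B ∧ x ∉ upStar c (A : Set X) B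

/-- LGL spaces. -/
structure IsLGLSpace {X : Type u} [TopologicalSpace X] (c : X → X → Set X) : Prop where
  stone : IsStoneSpace X
  star_clopen : ∀ A B : Clopens X, IsClopen (clStar c (A : Set X) B)
  wand_clopen : ∀ A B : Clopens X, IsClopen (clWand c (A : Set X) B)
  dnaw_clopen : ∀ A B : Clopens X, IsClopen (clDnaw c (A : Set X) B)
  separation : ∀ x y z, x ∉ c y z →
    ∃ A B : Clopens X, y ∈ A ∧ z ∈ B ∧ x ∉ clStar c (A : Set X) B

/-- The axioms of a BI space. -/
structure IsBISpace {X : Type u} [TopologicalSpace X] [PartialOrder X]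
    (c : X → X → Set X) (E : Set X) : Prop where
  ilgl : IsILGLSpace c
  frame : IsBIFrame c E
  unit_clopen : IsClopen E

/-- The axioms of a BBI space. -/
structure IsBBISpace {X : Type u} [TopologicalSpace X]
    (c : X → X → Set X) (E : Set X) : Prop where
  lgl : IsLGLSpace c
  frame : IsBBIFrame c E
  unit_clopen : IsClopen E

/-- BI spaces. -/
structure BISp : Type (u + 1) where
  carrier : Type u
  [top : TopologicalSpace carrier]
  [order : PartialOrder carrier]
  comp : carrier → carrier → Set carrier
  unit : Set carrier
  isBISpace : IsBISpace comp unit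

attribute [instance] BISp.top BISp.order

instance : CoeSort BISp.{u} (Type u) := ⟨BISp.carrier⟩

/-- Morphisms of BI spaces: continuous BI morphisms. -/
structure BISp.Map (X Y : BISp.{u}) where
  toFun : X → Y
  continuous : Continuous toFun
  isBIMorphism : IsBIMorphism X.comp X.unit Y.comp Y.unit toFun

instance (X Y : BISp.{u}) : FunLike (BISp.Map X Y) X Y where
  coe := BISp.Map.toFun
  coe_injective := by rintro ⟨f, _, _⟩ ⟨g, _, _⟩ h; congr

instance : Category BISp.{u} where
  Hom := BISp.Map
  id X := ⟨fun x => x, continuous_id, IsBIMorphism.id _ _⟩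
  comp f g := ⟨fun x => g.toFun (f.toFun x), g.continuous.comp f.continuous,
    g.isBIMorphism.comp f.isBIMorphism⟩

instance : ConcreteCategory BISp.{u} BISp.Map where
  hom f := f
  ofHom f := f

/-- BBI spaces. -/
structure BBISp : Type (u + 1) where
  carrier : Type u
  [top : TopologicalSpace carrier]
  comp : carrier → carrier → Set carrier
  unit : Set carrier
  isBBISpace : IsBBISpace comp unit

attribute [instance] BBISp.top

instance : CoeSort BBISp.{u} (Type u) := ⟨BBISp.carrier⟩

/-- Morphisms of BBI spaces: continuous BBI morphisms. -/
structure BBISp.Map (X Y : BBISp.{u}) where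
  toFun : X → Y
  continuous : Continuous toFun
  isBBIMorphism : IsBBIMorphism X.comp X.unit Y.comp Y.unit toFun

instance (X Y : BBISp.{u}) : FunLike (BBISp.Map X Y) X Y where
  coe := BBISp.Map.toFun
  coe_injective := by rintro ⟨f, _, _⟩ ⟨g, _, _⟩ h; congr

instance : Category BBISp.{u} where
  Hom := BBISp.Map
  id X := ⟨fun x => x, continuous_id, IsBBIMorphism.id _ _⟩
  comp f g := ⟨fun x => g.toFun (f.toFun x), g.continuous.comp f.continuous,
    g.isBBIMorphism.comp f.isBBIMorphism⟩

instance : ConcreteCategory BBISp.{u} BBISp.Map where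
  hom f := f
  ofHom f := f

/-! ## From spaces to algebras -/

namespace BISp

variable (X : BISp.{u})

theorem isClopen_upImp (A B : ClopenUpperSet X) : IsClopen (upImp (A : Set X) B) := by
  have h : upImp (A : Set X) B = (lowerClosure ((A : Set X) \ B) : Set X)ᶜ := by
    ext x
    change (∀ y, x ≤ y → y ∈ A → y ∈ B) ↔ ¬ (∃ y, (y ∈ A ∧ y ∉ B) ∧ x ≤ y)
    constructor
    · rintro h ⟨y, ⟨hA, hB⟩, hxy⟩
      exact hB (h y hxy hA)
    · intro h y hxy hA
      by_contra hB
      exact h ⟨y, ⟨hA, hB⟩, hxy⟩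
  rw [h]
  exact (X.isBISpace.ilgl.esakia.lower_clopen _ (A.isClopen.diff B.isClopen)).compl

instance : DistribLattice (ClopenUpperSet X) :=
  DistribLattice.ofInfSupLe fun _ _ _ _ hx => hx.2.imp (⟨hx.1, ·⟩) (⟨hx.1, ·⟩)

/-- The clopen upwards-closed sets form a Heyting algebra under intersection, union and the
implication `upImp`. -/
instance : HeytingAlgebra (ClopenUpperSet X) :=
  HeytingAlgebra.ofHImp
    (fun A B => ⟨⟨upImp (A : Set X) B, isClopen_upImp X A B⟩,
      fun _ _ hxy hx z hyz => hx z (hxy.trans hyz)⟩)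
    (fun A B C => by
      constructor
      · intro h x hx
        exact h hx.1 x le_rfl hx.2
      · intro h x hx y hxy hB
        exact h ⟨A.upper hxy hx, hB⟩)

/-- The bunched structure on the clopen upwards-closed sets. -/
instance : BIStructure (ClopenUpperSet X) where
  star A B := ⟨⟨upStar X.comp (A : Set X) B, (X.isBISpace.ilgl.star_clopen A B).1⟩,
    (X.isBISpace.ilgl.star_clopen A B).2⟩
  wand A B := ⟨⟨upWand X.comp (A : Set X) B, (X.isBISpace.ilgl.wand_clopen A B).1⟩,
    (X.isBISpace.ilgl.wand_clopen A B).2⟩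
  emp := ⟨⟨X.unit, X.isBISpace.unit_clopen⟩, fun _ _ h he => X.isBISpace.frame.closure _ _ he h⟩
  star_comm A B := by
    apply ClopenUpperSet.ext
    ext x
    constructor
    · rintro ⟨w, y, z, h, hw, hy, hz⟩
      exact ⟨w, z, y, h, X.isBISpace.frame.comm _ _ _ hw, hz, hy⟩
    · rintro ⟨w, y, z, h, hw, hy, hz⟩
      exact ⟨w, z, y, h, X.isBISpace.frame.comm _ _ _ hw, hz, hy⟩
  star_assoc A B C := by
    have F := X.isBISpace.frame
    apply ClopenUpperSet.ext
    ext x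
    constructor
    · rintro ⟨w, t', z, h, hw, ⟨t, a, b, ht, htab, ha, hb⟩, hz⟩
      obtain ⟨s, s', w', h1, h2, h3, h4⟩ := F.assoc _ _ _ _ _ _ ht htab hw
      exact ⟨w', a, s', h3.trans h, h4, ha, ⟨s, b, z, h1, h2, hb, hz⟩⟩
    · rintro ⟨w, z, t', h, hw, hz, ⟨t, a, b, ht, htab, ha, hb⟩⟩
      obtain ⟨s, s', w', h1, h2, h3, h4⟩ :=
        F.assoc _ _ _ _ _ _ ht (F.comm _ _ _ htab) (F.comm _ _ _ hw)
      exact ⟨w', s', b, h3.trans h, F.comm _ _ _ h4, ⟨s, z, a, h1, F.comm _ _ _ h2, hz, ha⟩, hb⟩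
  star_emp A := by
    apply ClopenUpperSet.ext
    ext x
    constructor
    · rintro ⟨w, y, e, h, hw, hy, he⟩
      exact A.upper ((X.isBISpace.frame.coherence _ _ _ he hw).trans h) hy
    · intro hx
      obtain ⟨e, he, hxe⟩ := X.isBISpace.frame.unit_exists x
      exact ⟨x, x, e, le_rfl, hxe, hx, he⟩
  star_le_iff A B C := by
    constructor
    · intro h x hx w y z hxw hz hy
      exact h ⟨z, w, y, le_rfl, hz, A.upper hxw hx, hy⟩
    · rintro h x ⟨w, y, z, hwx, hw, hy, hz⟩
      exact C.upper hwx (h hy y z w le_rfl hw hz)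
  star_le_iff' A B C := by
    have F := X.isBISpace.frame
    constructor
    · intro h x hx w y z hxw hz hy
      exact h ⟨z, y, w, le_rfl, F.comm _ _ _ hz, hy, B.upper hxw hx⟩
    · rintro h x ⟨w, y, z, hwx, hw, hy, hz⟩
      exact C.upper hwx (h hz z y w le_rfl (F.comm _ _ _ hw) hy)

variable {X} {Y : BISp.{u}}

/-- The inverse image of clopen upwards-closed sets along a morphism of BI spaces. -/
def preimage (g : X ⟶ Y) : BIHom (ClopenUpperSet Y) (ClopenUpperSet X) where
  toFun A := ⟨⟨g ⁻¹' (A : Set Y), A.isClopen.preimage (BISp.Map.continuous g)⟩,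
    fun _ _ h hx => A.upper ((BISp.Map.isBIMorphism g).mono _ _ h) hx⟩
  map_sup' _ _ := rfl
  map_inf' _ _ := rfl
  map_bot' := rfl
  map_himp' A B := by
    have M := BISp.Map.isBIMorphism g
    apply ClopenUpperSet.ext
    ext x
    constructor
    · intro h y hxy hy
      exact h _ (M.mono _ _ hxy) hy
    · intro h y' hxy hy
      obtain ⟨y, h1, rfl⟩ := M.back_le _ _ hxy
      exact h y h1 hy
  map_star' A B := by
    have M := BISp.Map.isBIMorphism g
    apply ClopenUpperSet.ext
    ext x
    constructor
    · rintro ⟨w', y', z', h, hw, hy, hz⟩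
      obtain ⟨w, y, z, h1, h2, h3, h4⟩ := M.back_star _ _ _ _ h hw
      exact ⟨w, y, z, h1, h2, A.upper h3 hy, B.upper h4 hz⟩
    · rintro ⟨w, y, z, h, hw, hy, hz⟩
      exact ⟨g w, g y, g z, M.mono _ _ h, M.forth _ _ _ hw, hy, hz⟩
  map_wand' A B := by
    have M := BISp.Map.isBIMorphism g
    apply ClopenUpperSet.ext
    ext x
    constructor
    · intro h w y z hxw hz hy
      exact h (g w) (g y) (g z) (M.mono _ _ hxw) (M.forth _ _ _ hz) hy
    · intro h w' y' z' hxw hz hy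
      obtain ⟨w, y, z, h1, h2, h3, h4⟩ := M.back_wand _ _ _ _ hxw hz
      exact B.upper h4 (h w y z h1 h2 (A.upper h3 hy))
  map_emp' := by
    apply ClopenUpperSet.ext
    ext x
    exact ((BISp.Map.isBIMorphism g).unit_iff x).symm

end BISp

/-- The functor sending a BI space to the BI algebra of its clopen upwards-closed sets and a
morphism to its inverse image map. -/
def clopBI : BISp.{u}ᵒᵖ ⥤ BIAlg.{u} where
  obj X := ⟨ClopenUpperSet X.unop⟩
  map g := BISp.preimage g.unop

namespace BBISp

variable (X : BBISp.{u})

/-- The bunched structure on the Boolean algebra of clopen sets. -/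
instance : BIStructure (Clopens X) where
  star A B := ⟨clStar X.comp (A : Set X) B, X.isBBISpace.lgl.star_clopen A B⟩
  wand A B := ⟨clWand X.comp (A : Set X) B, X.isBBISpace.lgl.wand_clopen A B⟩
  emp := ⟨X.unit, X.isBBISpace.unit_clopen⟩
  star_comm A B := by
    apply Clopens.ext
    ext x
    constructor
    · rintro ⟨y, z, hy, hz, hx⟩
      exact ⟨z, y, hz, hy, X.isBBISpace.frame.comm _ _ _ hx⟩
    · rintro ⟨y, z, hy, hz, hx⟩
      exact ⟨z, y, hz, hy, X.isBBISpace.frame.comm _ _ _ hx⟩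
  star_assoc A B C := by
    have F := X.isBBISpace.frame
    apply Clopens.ext
    ext x
    constructor
    · rintro ⟨t, z, ⟨a, b, ha, hb, ht⟩, hz, hx⟩
      obtain ⟨s, h1, h2⟩ := F.assoc _ _ _ _ _ ht hx
      exact ⟨a, s, ha, ⟨b, z, hb, hz, h1⟩, h2⟩
    · rintro ⟨z, t, hz, ⟨a, b, ha, hb, ht⟩, hx⟩
      obtain ⟨s, h1, h2⟩ := F.assoc _ _ _ _ _ (F.comm _ _ _ ht) (F.comm _ _ _ hx)
      exact ⟨s, b, ⟨z, a, hz, ha, F.comm _ _ _ h1⟩, hb, F.comm _ _ _ h2⟩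
  star_emp A := by
    apply Clopens.ext
    ext x
    constructor
    · rintro ⟨y, e, hy, he, hx⟩
      obtain rfl := X.isBBISpace.frame.coherence _ _ _ hx he
      exact hy
    · intro hx
      obtain ⟨e, he, hxe⟩ := X.isBBISpace.frame.unit_exists x
      exact ⟨x, e, hx, he, hxe⟩
  star_le_iff A B C := by
    constructor
    · intro h x hx y z hz hy
      exact h ⟨x, y, hx, hy, hz⟩
    · rintro h x ⟨y, z, hy, hz, hx⟩
      exact h hy z x hx hz
  star_le_iff' A B C := by
    have F := X.isBBISpace.frame
    constructor
    · intro h x hx y z hz hy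
      exact h ⟨y, x, hy, hx, F.comm _ _ _ hz⟩
    · rintro h x ⟨y, z, hy, hz, hx⟩
      exact h hz y x (F.comm _ _ _ hx) hy

variable {X} {Y : BBISp.{u}}

/-- The inverse image of clopen sets along a morphism of BBI spaces. -/
def preimage (g : X ⟶ Y) : BIHom (Clopens Y) (Clopens X) where
  toFun A := ⟨g ⁻¹' (A : Set Y), A.isClopen.preimage (BBISp.Map.continuous g)⟩
  map_sup' _ _ := rfl
  map_inf' _ _ := rfl
  map_bot' := rfl
  map_himp' A B := by
    apply Clopens.ext
    ext x
    change x ∈ g ⁻¹' ((A : Set Y) ⇨ (B : Set Y)) ↔ x ∈ (g ⁻¹' (A : Set Y)) ⇨ (g ⁻¹' (B : Set Y))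
    rw [himp_eq, himp_eq]
    rfl
  map_star' A B := by
    have M := BBISp.Map.isBBIMorphism g
    apply Clopens.ext
    ext x
    constructor
    · rintro ⟨y', z', hy, hz, hx⟩
      obtain ⟨y, z, h, rfl, rfl⟩ := M.back_star _ _ _ hx
      exact ⟨y, z, hy, hz, h⟩
    · rintro ⟨y, z, hy, hz, hx⟩
      exact ⟨g y, g z, hy, hz, M.forth _ _ _ hx⟩
  map_wand' A B := by
    have M := BBISp.Map.isBBIMorphism g
    apply Clopens.ext
    ext x
    constructor
    · intro h y z hz hy
      exact h (g y) (g z) (M.forth _ _ _ hz) hy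
    · intro h y' z' hz hy
      obtain ⟨y, z, h1, rfl, rfl⟩ := M.back_wand _ _ _ hz
      exact h y z h1 hy
  map_emp' := by
    apply Clopens.ext
    ext x
    exact ((BBISp.Map.isBBIMorphism g).unit_iff x).symm

end BBISp

/-- The functor sending a BBI space to the BBI algebra of its clopen sets and a morphism to its
inverse image map. -/
def clopBBI : BBISp.{u}ᵒᵖ ⥤ BBIAlg.{u} where
  obj X := ⟨Clopens X.unop⟩
  map g := BBISp.preimage g.unop

/-! ## From algebras to spaces -/

/-- The (proper) prime filters of a lattice, ordered by inclusion. -/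
abbrev PrimeFilter (A : Type u) [Lattice A] : Type u :=
  {F : Order.PFilter A // F.IsPrime}

section PrimeFilter

variable {A B : Type u} [HeytingAlgebra A] [HeytingAlgebra B] [BIStructure A] [BIStructure B]

/-- `θ(a)`: the set of prime filters containing `a`. -/
def thetaSet (a : A) : Set (PrimeFilter A) := {F | a ∈ F.1}

/-- The composition of prime filters. -/
def primeComp (F G : PrimeFilter A) : Set (PrimeFilter A) :=
  {H | ∀ a ∈ F.1, ∀ b ∈ G.1, star a b ∈ H.1}

/-- The set of prime filters containing the monoidal unit. -/
def primeUnit (A : Type u) [HeytingAlgebra A] [BIStructure A] : Set (PrimeFilter A) :=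
  {F | emp ∈ F.1}

/-- The topology with subbase the sets `θ(a)` and their complements. -/
@[reducible] def esakiaTopology (A : Type u) [HeytingAlgebra A] : TopologicalSpace (PrimeFilter A) :=
  generateFrom ({S | ∃ a : A, S = thetaSet a} ∪ {S | ∃ a : A, S = (thetaSet a)ᶜ})

/-- The topology generated by the sets `θ(a)` (used for Boolean algebras). -/
@[reducible] def stoneTopology (A : Type u) [HeytingAlgebra A] : TopologicalSpace (PrimeFilter A) :=
  generateFrom {S | ∃ a : A, S = thetaSet a}

/-- The inverse image of a prime filter along a homomorphism. -/
def primeComap (f : BIHom A B) (F : PrimeFilter B) : PrimeFilter A :=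
  ⟨(Order.IsPFilter.of_def (F := {a | f a ∈ F.1})
      ⟨⊤, by
        change f.toHeytingHom ⊤ ∈ F.1
        rw [map_top]
        exact Order.PFilter.top_mem⟩
      (fun a ha b hb => ⟨a ⊓ b, by
        change f.toHeytingHom (a ⊓ b) ∈ F.1
        rw [map_inf]
        exact Order.PFilter.inf_mem ha hb, inf_le_left, inf_le_right⟩)
      (fun {a b} hab ha => by
        have h : f.toHeytingHom a ≤ f.toHeytingHom b := OrderHomClass.mono f.toHeytingHom hab
        exact Order.PFilter.mem_of_le (F := F.1) h ha)).toPFilter,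
    ⟨{ IsLowerSet := fun a b hba ha hb => by
        have h : f.toHeytingHom b ≤ f.toHeytingHom a := OrderHomClass.mono f.toHeytingHom hba
        exact ha (Order.PFilter.mem_of_le (F := F.1) h hb)
       Nonempty := ⟨⊥, by
        change f.toHeytingHom ⊥ ∉ F.1
        rw [map_bot]
        obtain ⟨b, hb⟩ := F.2.compl_ideal.Nonempty
        exact F.2.compl_ideal.IsLowerSet bot_le hb⟩
       Directed := fun a ha b hb => ⟨a ⊔ b, by
        change f.toHeytingHom (a ⊔ b) ∉ F.1
        rw [map_sup]
        obtain ⟨c, hc, hac, hbc⟩ := F.2.compl_ideal.Directed _ ha _ hb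
        exact F.2.compl_ideal.IsLowerSet (sup_le hac hbc) hc, le_sup_left, le_sup_right⟩ }⟩⟩

end PrimeFilter

/-- Well-definedness of the prime filter construction for BI algebras: prime filters form a BI
space, and inverse images along homomorphisms are continuous BI morphisms. -/
structure PrBIWellDefined : Prop where
  space : ∀ A : BIAlg.{u},
    @IsBISpace (PrimeFilter A) (esakiaTopology A) _ primeComp (primeUnit A)
  continuous : ∀ (A B : BIAlg.{u}) (f : BIHom A B),
    @Continuous _ _ (esakiaTopology B) (esakiaTopology A) (primeComap f)
  morphism : ∀ (A B : BIAlg.{u}) (f : BIHom A B),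
    IsBIMorphism primeComp (primeUnit B) primeComp (primeUnit A) (primeComap f)

/-- The functor sending a BI algebra to its prime filter space and a homomorphism to its inverse
image map; `h` only records that this makes sense. -/
def prBI (h : PrBIWellDefined.{u}) : BIAlg.{u} ⥤ BISp.{u}ᵒᵖ where
  obj A := op
    { carrier := PrimeFilter A
      top := esakiaTopology A
      comp := primeComp
      unit := primeUnit A
      isBISpace := h.space A }
  map {A B} f := Quiver.Hom.op
    (BISp.Map.mk (primeComap f) (h.continuous A B f) (h.morphism A B f))
  map_id _ := rfl
  map_comp _ _ := rfl

/-- The map `θ` from a BI algebra to the clopen upwards-closed sets of its prime filter space. -/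
def thetaBI (h : PrBIWellDefined.{u}) (A : BIAlg.{u}) (a : A) :
    ClopenUpperSet ((prBI h).obj A).unop :=
  ⟨⟨thetaSet a,
      ⟨⟨isOpen_generateFrom_of_mem (Or.inr ⟨a, rfl⟩)⟩,
        isOpen_generateFrom_of_mem (Or.inl ⟨a, rfl⟩)⟩⟩,
    fun _ _ hFG hF => hFG hF⟩

/-- The map `η` from a BI space to the prime filters of its clopen upwards-closed sets. -/
def etaBI (X : BISp.{u}) (x : X) : PrimeFilter (ClopenUpperSet X) :=
  ⟨(Order.IsPFilter.of_def (F := {U : ClopenUpperSet X | x ∈ U})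
      ⟨⊤, Set.mem_univ x⟩
      (fun U hU V hV => ⟨U ⊓ V, ⟨hU, hV⟩, inf_le_left, inf_le_right⟩)
      (fun hUV hU => hUV hU)).toPFilter,
    ⟨{ IsLowerSet := fun _ _ hVU hU hV => hU (hVU hV)
       Nonempty := ⟨⊥, Set.notMem_empty x⟩
       Directed := fun U hU V hV => ⟨U ⊔ V, fun h => h.elim hU hV, le_sup_left, le_sup_right⟩ }⟩⟩

/-- Well-definedness of the prime filter construction for BBI algebras. -/
structure PrBBIWellDefined : Prop where
  space : ∀ A : BBIAlg.{u},
    @IsBBISpace (PrimeFilter A) (stoneTopology A) primeComp (primeUnit A)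
  continuous : ∀ (A B : BBIAlg.{u}) (f : BIHom A B),
    @Continuous _ _ (stoneTopology B) (stoneTopology A) (primeComap f)
  morphism : ∀ (A B : BBIAlg.{u}) (f : BIHom A B),
    IsBBIMorphism primeComp (primeUnit B) primeComp (primeUnit A) (primeComap f)

/-- The functor sending a BBI algebra to its prime filter space and a homomorphism to its inverse
image map; `h` only records that this makes sense. -/
def prBBI (h : PrBBIWellDefined.{u}) : BBIAlg.{u} ⥤ BBISp.{u}ᵒᵖ where
  obj A := op
    { carrier := PrimeFilter A
      top := stoneTopology A
      comp := primeComp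
      unit := primeUnit A
      isBBISpace := h.space A }
  map {A B} f := Quiver.Hom.op
    (BBISp.Map.mk (primeComap f) (h.continuous A B f) (h.morphism A B f))
  map_id _ := rfl
  map_comp _ _ := rfl

/-- In a Boolean algebra the complement of `θ(a)` is `θ(aᶜ)`. -/
theorem compl_thetaSet {A : Type u} [BooleanAlgebra A] (a : A) :
    (thetaSet a)ᶜ = thetaSet aᶜ := by
  ext F
  have hp := F.2.compl_ideal
  change a ∉ F.1 ↔ aᶜ ∈ F.1
  constructor
  · intro ha
    by_contra hc
    obtain ⟨c, h, h1, h2⟩ := hp.Directed a ha aᶜ hc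
    apply h
    have : (⊤ : A) ≤ c := sup_compl_eq_top (x := a) ▸ sup_le h1 h2
    exact Order.PFilter.mem_of_le this Order.PFilter.top_mem
  · intro hc ha
    obtain ⟨b, hb⟩ := hp.Nonempty
    apply hb
    have : a ⊓ aᶜ ∈ F.1 := Order.PFilter.inf_mem ha hc
    exact Order.PFilter.mem_of_le (inf_compl_eq_bot.le.trans bot_le) this

/-- The map `θ` from a BBI algebra to the clopen sets of its prime filter space. -/
def thetaBBI (h : PrBBIWellDefined.{u}) (A : BBIAlg.{u}) (a : A) :
    Clopens ((prBBI h).obj A).unop :=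
  ⟨thetaSet a,
    ⟨⟨isOpen_generateFrom_of_mem ⟨aᶜ, compl_thetaSet a⟩⟩, isOpen_generateFrom_of_mem ⟨a, rfl⟩⟩⟩

/-- The map `η` from a BBI space to the prime filters of its clopen sets. -/
def etaBBI (X : BBISp.{u}) (x : X) : PrimeFilter (Clopens X) :=
  ⟨(Order.IsPFilter.of_def (F := {U : Clopens X | x ∈ U})
      ⟨⊤, Set.mem_univ x⟩
      (fun U hU V hV => ⟨U ⊓ V, ⟨hU, hV⟩, inf_le_left, inf_le_right⟩)
      (fun hUV hU => hUV hU)).toPFilter,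
    ⟨{ IsLowerSet := fun _ _ hVU hU hV => hU (hVU hV)
       Nonempty := ⟨⊥, Set.notMem_empty x⟩
       Directed := fun U hU V hV => ⟨U ⊔ V, fun h => h.elim hU hV, le_sup_left, le_sup_right⟩ }⟩⟩

end BunchedDuality

open BunchedDuality

/-! The duality extends Esakia (or Stone) duality, and two tools carry it: extension of filter bases
to prime filters, and compactness.

Extension starts from the prime ideal theorem (`PrimeFilter.exists_of_separated`). For a prime
filter `H` and an inf-closed `S`, the elements `b` with `star a b ∉ H` for some `a ∈ S` form an
ideal, because `star a` is a left adjoint and so preserves finite joins. A filter base avoiding this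
ideal therefore extends to a prime filter that still composes with `S` into `H`
(`PrimeFilter.exists_extend_right`). This yields the frame axioms on prime filters, the back
conditions for inverse images, and the fact that `θ` turns `star` and `wand` into the set
operations.

Compactness of the prime filter space shows that the clopen up-sets are exactly the sets `θ(a)`
(`exists_thetaSet_eq`) and that down-closures of clopens are clopen; hence prime filters form a BI
space and `θ` is bijective. Compactness of a given space shows that every prime filter of clopens
comes from a point (`exists_mem_iff_of_clopen`). So `η` is a continuous bijection from a compact
space to a Hausdorff one; it preserves and reflects composition by the separation axiom, and is an
isomorphism.

The Boolean prime filter space is a special case: there prime filters are ordered discretely and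
both topologies agree, so each BI notion collapses to its BBI counterpart. -/

namespace BunchedDuality

open BIStructure Set Topology

/-! ## Bunched structures and homomorphisms -/

section BIStructure

variable {A B : Type u} [HeytingAlgebra A] [HeytingAlgebra B] [BIStructure A] [BIStructure B]

theorem star_mono {a a' b b' : A} (ha : a ≤ a') (hb : b ≤ b') : star a b ≤ star a' b' := by
  have h1 : star a b ≤ star a' b :=
    (star_le_iff _ _ _).2 (ha.trans ((star_le_iff _ _ _).1 le_rfl))
  have h2 : star a' b ≤ star a' b' :=
    (star_le_iff' _ _ _).2 (hb.trans ((star_le_iff' _ _ _).1 le_rfl))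
  exact h1.trans h2

/-- Residuation makes `star a` a left adjoint, so it preserves finite joins, binary here and empty
in `star_bot`. This is what makes the excluded elements in `PrimeFilter.exists_extend_right` an
ideal. -/
theorem star_sup (a b c : A) : star a (b ⊔ c) = star a b ⊔ star a c :=
  le_antisymm
    ((star_le_iff' _ _ _).2 (sup_le ((star_le_iff' _ _ _).1 le_sup_left)
      ((star_le_iff' _ _ _).1 le_sup_right)))
    (sup_le (star_mono le_rfl le_sup_left) (star_mono le_rfl le_sup_right))

theorem star_bot (a : A) : star a ⊥ = ⊥ :=
  le_bot_iff.1 ((star_le_iff' _ _ _).2 bot_le)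

theorem star_wand_le (a b : A) : star (wand a b) a ≤ b := (star_le_iff _ _ _).2 le_rfl

namespace BIHom

theorem map_sup (f : BIHom A B) (a b : A) : f (a ⊔ b) = f a ⊔ f b := f.map_sup' a b
theorem map_inf (f : BIHom A B) (a b : A) : f (a ⊓ b) = f a ⊓ f b := f.map_inf' a b
theorem map_bot (f : BIHom A B) : f ⊥ = ⊥ := f.map_bot'
theorem map_himp (f : BIHom A B) (a b : A) : f (a ⇨ b) = f a ⇨ f b := f.map_himp' a b
theorem map_star (f : BIHom A B) (a b : A) : f (star a b) = star (f a) (f b) := f.map_star' a b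
theorem map_wand (f : BIHom A B) (a b : A) : f (wand a b) = wand (f a) (f b) := f.map_wand' a b
theorem map_emp (f : BIHom A B) : f emp = emp := f.map_emp'

/-- The inverse of a bijective homomorphism. -/
noncomputable def inverse (f : BIHom A B) (hf : Function.Bijective f) : BIHom B A :=
  have hr := Function.rightInverse_surjInv hf.2
  { toFun := Function.surjInv hf.2
    map_sup' a b := hf.1 ((hr _).trans <| by rw [map_sup, hr, hr])
    map_inf' a b := hf.1 ((hr _).trans <| by rw [map_inf, hr, hr])
    map_bot' := hf.1 ((hr _).trans (map_bot f).symm)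
    map_himp' a b := hf.1 ((hr _).trans <| by rw [map_himp, hr, hr])
    map_star' a b := hf.1 ((hr _).trans <| by
      rw [map_star]; exact congrArg₂ BIStructure.star (hr a).symm (hr b).symm)
    map_wand' a b := hf.1 ((hr _).trans <| by
      rw [map_wand]; exact congrArg₂ BIStructure.wand (hr a).symm (hr b).symm)
    map_emp' := hf.1 ((hr _).trans (map_emp f).symm) }

theorem inverse_apply_apply (f : BIHom A B) (hf : Function.Bijective f) (a : A) :
    f.inverse hf (f a) = a := Function.leftInverse_surjInv hf a

theorem apply_inverse_apply (f : BIHom A B) (hf : Function.Bijective f) (b : B) :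
    f (f.inverse hf b) = b := Function.rightInverse_surjInv hf.2 b

end BIHom

end BIStructure

/-! ## Prime filters -/

namespace PrimeFilter

variable {L : Type u}

section Lattice

variable [Lattice L]

@[ext] theorem ext {F G : PrimeFilter L} (h : ∀ a, a ∈ F.1 ↔ a ∈ G.1) : F = G :=
  Subtype.ext (SetLike.ext h)

theorem mem_of_le (F : PrimeFilter L) {a b : L} (h : a ≤ b) (ha : a ∈ F.1) : b ∈ F.1 :=
  Order.PFilter.mem_of_le h ha

theorem inf_mem (F : PrimeFilter L) {a b : L} (ha : a ∈ F.1) (hb : b ∈ F.1) : a ⊓ b ∈ F.1 :=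
  Order.PFilter.inf_mem ha hb

theorem sup_mem_iff (F : PrimeFilter L) {a b : L} : a ⊔ b ∈ F.1 ↔ a ∈ F.1 ∨ b ∈ F.1 := by
  constructor
  · intro h
    by_contra! hab
    obtain ⟨c, hc, h1, h2⟩ := F.2.compl_ideal.Directed a hab.1 b hab.2
    exact hc (F.mem_of_le (sup_le h1 h2) h)
  · rintro (h | h)
    · exact F.mem_of_le le_sup_left h
    · exact F.mem_of_le le_sup_right h

theorem inf_mem_iff (F : PrimeFilter L) {a b : L} : a ⊓ b ∈ F.1 ↔ a ∈ F.1 ∧ b ∈ F.1 :=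
  ⟨fun h => ⟨F.mem_of_le inf_le_left h, F.mem_of_le inf_le_right h⟩, fun h => F.inf_mem h.1 h.2⟩

theorem bot_notMem [OrderBot L] (F : PrimeFilter L) : ⊥ ∉ F.1 := by
  obtain ⟨b, hb⟩ := F.2.compl_ideal.Nonempty
  exact fun h => hb (F.mem_of_le bot_le h)

theorem top_mem [OrderTop L] (F : PrimeFilter L) : ⊤ ∈ F.1 := Order.PFilter.top_mem

theorem infClosed (F : PrimeFilter L) : InfClosed {a | a ∈ F.1} :=
  fun _ ha _ hb => F.inf_mem ha hb

/-- A prime filter from its set of elements. -/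
def ofSet [BoundedOrder L] (S : Set L) (top : ⊤ ∈ S) (bot : ⊥ ∉ S)
    (inf : ∀ a ∈ S, ∀ b ∈ S, a ⊓ b ∈ S) (sup : ∀ a b, a ⊔ b ∈ S → a ∈ S ∨ b ∈ S)
    (up : ∀ a b, a ≤ b → a ∈ S → b ∈ S) : PrimeFilter L :=
  ⟨(Order.IsPFilter.of_def (F := S) ⟨⊤, top⟩
      (fun a ha b hb => ⟨a ⊓ b, inf a ha b hb, inf_le_left, inf_le_right⟩)
      (fun {a b} h ha => up a b h ha)).toPFilter,
    ⟨{ IsLowerSet := fun a b hba ha hb => ha (up b a hba hb)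
       Nonempty := ⟨⊥, bot⟩
       Directed := fun a ha b hb =>
        ⟨a ⊔ b, fun h => (sup a b h).elim ha hb, le_sup_left, le_sup_right⟩ }⟩⟩

end Lattice

/-- This is the prime ideal theorem for the up-closure of `S` and the down-closure of `T`. Bases
replace filters and ideals because the applications supply images under homomorphisms and
singletons, which need not be closed upwards or downwards. -/
theorem exists_of_separated [DistribLattice L] {S T : Set L}
    (hS : S.Nonempty) (hS' : InfClosed S) (hT : T.Nonempty) (hT' : SupClosed T)
    (h : ∀ s ∈ S, ∀ t ∈ T, ¬ s ≤ t) :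
    ∃ G : PrimeFilter L, (∀ s ∈ S, s ∈ G.1) ∧ ∀ t ∈ T, t ∉ G.1 := by
  have hF : Order.IsPFilter {c : L | ∃ s ∈ S, s ≤ c} :=
    Order.IsPFilter.of_def (hS.imp fun s hs => ⟨s, hs, le_rfl⟩)
      (by
        rintro a ⟨s, hs, hsa⟩ b ⟨t, ht, htb⟩
        exact ⟨a ⊓ b, ⟨s ⊓ t, hS' hs ht, inf_le_inf hsa htb⟩, inf_le_left, inf_le_right⟩)
      (by
        rintro a b hab ⟨s, hs, hsa⟩
        exact ⟨s, hs, hsa.trans hab⟩)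
  have hI : Order.IsIdeal {c : L | ∃ t ∈ T, c ≤ t} :=
    { IsLowerSet := by
        rintro a b hba ⟨t, ht, hat⟩
        exact ⟨t, ht, hba.trans hat⟩
      Nonempty := hT.imp fun t ht => ⟨t, ht, le_rfl⟩
      Directed := by
        rintro a ⟨s, hs, hsa⟩ b ⟨t, ht, htb⟩
        exact ⟨a ⊔ b, ⟨s ⊔ t, hT' hs ht, sup_le_sup hsa htb⟩, le_sup_left, le_sup_right⟩ }
  obtain ⟨J, hJ, hIJ, hFJ⟩ := DistribLattice.prime_ideal_of_disjoint_filter_ideal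
    (F := hF.toPFilter) (I := hI.toIdeal) (by
      rw [Set.disjoint_left]
      rintro c ⟨s, hs, hsc⟩ ⟨t, ht, hct⟩
      exact h s hs t ht (hsc.trans hct))
  refine ⟨⟨hJ.toPrimePair.F, hJ.toPrimePair.F_isPrime⟩, fun s hs => ?_, fun t ht => ?_⟩
  · rw [← SetLike.mem_coe, ← hJ.toPrimePair.compl_I_eq_F]
    exact Set.disjoint_left.1 hFJ ⟨s, hs, le_rfl⟩
  · rw [← SetLike.mem_coe, ← hJ.toPrimePair.compl_I_eq_F]
    exact fun h => h (hIJ ⟨t, ht, le_rfl⟩)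

theorem exists_mem_notMem [DistribLattice L] {a b : L} (h : ¬ a ≤ b) :
    ∃ G : PrimeFilter L, a ∈ G.1 ∧ b ∉ G.1 := by
  obtain ⟨G, h1, h2⟩ := exists_of_separated (S := {a}) (T := {b}) (singleton_nonempty a)
    infClosed_singleton (singleton_nonempty b) supClosed_singleton (by
      rintro _ rfl _ rfl; exact h)
  exact ⟨G, h1 a rfl, h2 b rfl⟩

variable [HeytingAlgebra L] [BIStructure L]

/-- A filter base composing with `S` into a prime filter can be enlarged to a prime filter. -/
theorem exists_extend_right {S T : Set L} (hS : S.Nonempty) (hS' : InfClosed S)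
    (hT : T.Nonempty) (hT' : InfClosed T) (H : PrimeFilter L)
    (h : ∀ a ∈ S, ∀ b ∈ T, star a b ∈ H.1) :
    ∃ G : PrimeFilter L, (∀ b ∈ T, b ∈ G.1) ∧ ∀ a ∈ S, ∀ b ∈ G.1, star a b ∈ H.1 := by
  obtain ⟨a₀, ha₀⟩ := hS
  -- The set to avoid consists of all `b` whose product with some element of `S` falls outside `H`.
  -- It is closed under joins: witnesses `a`, `a'` combine to `a ⊓ a'`, and primeness of `H` splits
  -- the distributed product.
  obtain ⟨G, h1, h2⟩ := exists_of_separated (S := T) (T := {b | ∃ a ∈ S, star a b ∉ H.1}) hT hT'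
    ⟨⊥, a₀, ha₀, by rw [star_bot]; exact H.bot_notMem⟩
    (by
      rintro b ⟨a, ha, hb⟩ b' ⟨a', ha', hb'⟩
      refine ⟨a ⊓ a', hS' ha ha', fun hm => ?_⟩
      rw [star_sup] at hm
      rcases H.sup_mem_iff.1 hm with hm | hm
      · exact hb (H.mem_of_le (star_mono inf_le_left le_rfl) hm)
      · exact hb' (H.mem_of_le (star_mono inf_le_right le_rfl) hm))
    (by
      rintro s hs t ⟨a, ha, hat⟩ hst
      exact hat (H.mem_of_le (star_mono le_rfl hst) (h a ha s hs)))
  refine ⟨G, h1, fun a ha b hb => ?_⟩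
  by_contra hab
  exact h2 b ⟨a, ha, hab⟩ hb

/-- Two one-sided extensions suffice: `T` is enlarged against `S`, then `S` against the resulting
prime filter, with commutativity exchanging the sides. -/
theorem exists_extend {S T : Set L} (hS : S.Nonempty) (hS' : InfClosed S)
    (hT : T.Nonempty) (hT' : InfClosed T) (H : PrimeFilter L)
    (h : ∀ a ∈ S, ∀ b ∈ T, star a b ∈ H.1) :
    ∃ F G : PrimeFilter L, (∀ a ∈ S, a ∈ F.1) ∧ (∀ b ∈ T, b ∈ G.1) ∧ H ∈ primeComp F G := by
  obtain ⟨G, h1, h2⟩ := exists_extend_right hS hS' hT hT' H h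
  obtain ⟨F, h3, h4⟩ := exists_extend_right (S := {b | b ∈ G.1}) ⟨⊤, G.top_mem⟩ G.infClosed
    hS hS' H (fun b hb a ha => by rw [star_comm]; exact h2 a ha b hb)
  exact ⟨F, G, h3, h1, fun a ha b hb => by rw [star_comm]; exact h4 b hb a ha⟩

end PrimeFilter

/-! ## The map `θ` -/

section Theta

variable {A : Type u} [HeytingAlgebra A]

theorem thetaSet_inf (a b : A) : thetaSet (a ⊓ b) = thetaSet a ∩ thetaSet b :=
  Set.ext fun F => F.inf_mem_iff

theorem thetaSet_sup (a b : A) : thetaSet (a ⊔ b) = thetaSet a ∪ thetaSet b :=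
  Set.ext fun F => F.sup_mem_iff

theorem thetaSet_bot : thetaSet (⊥ : A) = ∅ :=
  Set.eq_empty_of_forall_notMem fun F => F.bot_notMem

theorem thetaSet_subset_iff {a b : A} : thetaSet a ⊆ thetaSet b ↔ a ≤ b := by
  refine ⟨fun h => ?_, fun h F ha => F.mem_of_le h ha⟩
  by_contra hab
  obtain ⟨G, h1, h2⟩ := PrimeFilter.exists_mem_notMem hab
  exact h2 (h h1)

theorem thetaSet_injective : Function.Injective (thetaSet : A → Set (PrimeFilter A)) :=
  fun _ _ h => le_antisymm (thetaSet_subset_iff.1 h.le) (thetaSet_subset_iff.1 h.ge)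

theorem isUpperSet_thetaSet (a : A) : IsUpperSet (thetaSet a) := fun _ _ h ha => h ha

theorem thetaSet_himp (a b : A) : thetaSet (a ⇨ b) = upImp (thetaSet a) (thetaSet b) := by
  ext F
  constructor
  · intro h G hFG ha
    exact G.mem_of_le himp_inf_le (G.inf_mem (hFG h) ha)
  · intro h
    by_contra hab
    -- The filter generated by `F` and `a` avoids `b`: `x ⊓ a ≤ b` with `x ∈ F` would put `a ⇨ b` in
    -- `F`.
    obtain ⟨G, h1, h2⟩ := PrimeFilter.exists_of_separated (S := {c | ∃ x ∈ F.1, c = x ⊓ a})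
      (T := {b}) ⟨_, ⊤, F.top_mem, rfl⟩
      (by
        rintro _ ⟨x, hx, rfl⟩ _ ⟨y, hy, rfl⟩
        exact ⟨x ⊓ y, F.inf_mem hx hy, (inf_inf_distrib_right _ _ _).symm⟩)
      (singleton_nonempty b) supClosed_singleton
      (by
        rintro _ ⟨x, hx, rfl⟩ _ rfl hle
        exact hab (F.mem_of_le (le_himp_iff.2 hle) hx))
    refine h2 b rfl (h G (fun x hx => G.mem_of_le inf_le_left (h1 _ ⟨x, hx, rfl⟩)) ?_)
    exact h1 _ ⟨⊤, F.top_mem, (top_inf_eq a).symm⟩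

end Theta

/-! ## Composition of prime filters -/

section PrimeComp

variable {A B : Type u} [HeytingAlgebra A] [HeytingAlgebra B] [BIStructure A] [BIStructure B]

theorem primeComp_comm {F G H : PrimeFilter A} (h : H ∈ primeComp F G) : H ∈ primeComp G F :=
  fun a ha b hb => by rw [star_comm]; exact h b hb a ha

/-- A base composing with a prime filter `F`: if `star F S` avoids an ideal base `T`, there are
prime filters `G ⊇ S` and `H` avoiding `T` with `H ∈ F ∘ G`. -/
theorem exists_primeComp_of_separated (F : PrimeFilter A) {S T : Set A}
    (hS : S.Nonempty) (hS' : InfClosed S) (hT : T.Nonempty) (hT' : SupClosed T)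
    (h : ∀ a ∈ F.1, ∀ s ∈ S, ∀ t ∈ T, ¬ star a s ≤ t) :
    ∃ G H : PrimeFilter A, (∀ s ∈ S, s ∈ G.1) ∧ (∀ t ∈ T, t ∉ H.1) ∧ H ∈ primeComp F G := by
  obtain ⟨s₀, hs₀⟩ := hS
  -- `H` is chosen first, containing all products of `F` with `S` and avoiding `T`; only then is `S`
  -- enlarged to `G` against this fixed `H`.
  obtain ⟨H, h1, h2⟩ := PrimeFilter.exists_of_separated
    (S := {c | ∃ a ∈ F.1, ∃ s ∈ S, star a s ≤ c}) (T := T)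
    ⟨⊤, ⊤, F.top_mem, s₀, hs₀, le_top⟩
    (by
      rintro c ⟨a, ha, s, hs, hc⟩ c' ⟨a', ha', s', hs', hc'⟩
      exact ⟨a ⊓ a', F.inf_mem ha ha', s ⊓ s', hS' hs hs',
        le_inf ((star_mono inf_le_left inf_le_left).trans hc)
          ((star_mono inf_le_right inf_le_right).trans hc')⟩)
    hT hT'
    (by
      rintro c ⟨a, ha, s, hs, hc⟩ t ht hct
      exact h a ha s hs t ht (hc.trans hct))
  obtain ⟨G, h3, h4⟩ := PrimeFilter.exists_extend_right (S := {a | a ∈ F.1}) ⟨⊤, F.top_mem⟩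
    F.infClosed ⟨s₀, hs₀⟩ hS' H (fun a ha s hs => h1 _ ⟨a, ha, s, hs, le_rfl⟩)
  exact ⟨G, H, h3, h2, h4⟩

/-- Both existence axioms are one-sided extensions. For units, `{emp}` composes with `F` into `F`.
For associativity, the filter base of products of `Y` and `Z` composes with `X` into `W`, since
products reassociate; the inequalities between the witnesses are then equalities. -/
theorem isBIFrame_primeComp : IsBIFrame (X := PrimeFilter A) primeComp (primeUnit A) where
  comm _ _ _ h := primeComp_comm h
  closure _ _ he h := h he
  unit_exists F := by
    obtain ⟨E, h1, h2⟩ := PrimeFilter.exists_extend_right (S := {a | a ∈ F.1}) (T := {emp})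
      ⟨⊤, F.top_mem⟩ F.infClosed (singleton_nonempty _) infClosed_singleton F (by
        rintro a ha _ rfl
        rwa [star_emp])
    exact ⟨E, h1 _ rfl, h2⟩
  coherence F G e he h a ha := by
    have := h a ha emp he
    rwa [star_emp] at this
  assoc X Y Z T T' W hT hXY hW := by
    obtain ⟨S, h1, h2⟩ := PrimeFilter.exists_extend_right (S := {a | a ∈ X.1})
      (T := {c | ∃ b ∈ Y.1, ∃ d ∈ Z.1, star b d ≤ c})
      ⟨⊤, X.top_mem⟩ X.infClosed ⟨⊤, ⊤, Y.top_mem, ⊤, Z.top_mem, le_top⟩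
      (by
        rintro c ⟨a, ha, s, hs, hc⟩ c' ⟨a', ha', s', hs', hc'⟩
        exact ⟨a ⊓ a', Y.inf_mem ha ha', s ⊓ s', Z.inf_mem hs hs',
          le_inf ((star_mono inf_le_left inf_le_left).trans hc)
            ((star_mono inf_le_right inf_le_right).trans hc')⟩)
      W
      (by
        rintro a ha c ⟨b, hb, d, hd, hc⟩
        refine W.mem_of_le (star_mono le_rfl hc) ?_
        rw [← star_assoc]
        exact hW _ (hT (hXY a ha b hb)) d hd)
    exact ⟨S, S, W, le_rfl, fun b hb d hd => h1 _ ⟨b, hb, d, hd, le_rfl⟩, le_rfl, h2⟩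

theorem infClosed_image (f : BIHom A B) (F : PrimeFilter A) : InfClosed (f '' {a | a ∈ F.1}) := by
  rintro _ ⟨a, ha, rfl⟩ _ ⟨b, hb, rfl⟩
  exact ⟨a ⊓ b, F.inf_mem ha hb, f.map_inf a b⟩

theorem supClosed_image (f : BIHom A B) (F : PrimeFilter A) : SupClosed (f '' {a | a ∉ F.1}) := by
  rintro _ ⟨a, ha, rfl⟩ _ ⟨b, hb, rfl⟩
  exact ⟨a ⊔ b, fun h => (F.sup_mem_iff.1 h).elim ha hb, f.map_sup a b⟩

/-- `G` must contain `f(Y)` and `H` must avoid `f` of the complement of `Z`. An obstruction `star a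
(f y) ≤ f c` with `a ∈ X` would place `f (wand y c)` in `X`, hence `wand y c` in `W`; composing with
`y ∈ Y` would force `c ∈ Z`. -/
theorem primeComap_back_wand (f : BIHom A B) (X : PrimeFilter B) (W Y Z : PrimeFilter A)
    (hXW : primeComap f X ≤ W) (hZ : Z ∈ primeComp W Y) :
    ∃ G H : PrimeFilter B, H ∈ primeComp X G ∧ Y ≤ primeComap f G ∧ primeComap f H ≤ Z := by
  obtain ⟨G, H, h1, h2, h3⟩ := exists_primeComp_of_separated X
    (Set.Nonempty.image f ⟨⊤, Y.top_mem⟩) (infClosed_image f Y)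
    (Set.Nonempty.image f ⟨⊥, Z.bot_notMem⟩) (supClosed_image f Z) (by
      rintro a ha _ ⟨y, hy, rfl⟩ _ ⟨c, hc, rfl⟩ hle
      have h : wand y c ∈ W.1 := hXW (show f (wand y c) ∈ X.1 by
        rw [f.map_wand]
        exact X.mem_of_le ((star_le_iff _ _ _).1 hle) ha)
      exact hc (Z.mem_of_le (star_wand_le y c) (hZ _ h y hy)))
  refine ⟨G, H, h3, fun y hy => h1 _ ⟨y, hy, rfl⟩, fun c hc => ?_⟩
  by_contra hcZ
  exact h2 _ ⟨c, hcZ, rfl⟩ hc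

/-- Each back condition reflects one preserved operation: `⇨` for the order, `star` for composition,
`wand` for the two residual conditions, which are exchanged by commutativity. -/
theorem isBIMorphism_primeComap (f : BIHom A B) :
    IsBIMorphism primeComp (primeUnit B) primeComp (primeUnit A) (primeComap f) where
  mono _ _ h _ ha := h ha
  back_le X Y hXY := by
    -- `G` contains `X` and `f(Y)` and avoids `f` of the complement of `Y`, so its inverse image is
    -- exactly `Y`. An obstruction `a ⊓ f y ≤ f c` would put `y ⇨ c` in `Y`, and then `c` as well.
    obtain ⟨G, h1, h2⟩ := PrimeFilter.exists_of_separated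
      (S := {c | ∃ a ∈ X.1, ∃ y ∈ Y.1, c = a ⊓ f y}) (T := f '' {a | a ∉ Y.1})
      ⟨_, ⊤, X.top_mem, ⊤, Y.top_mem, rfl⟩
      (by
        rintro _ ⟨a, ha, y, hy, rfl⟩ _ ⟨a', ha', y', hy', rfl⟩
        refine ⟨a ⊓ a', X.inf_mem ha ha', y ⊓ y', Y.inf_mem hy hy', ?_⟩
        rw [f.map_inf]
        exact inf_inf_inf_comm _ _ _ _)
      (Set.Nonempty.image f ⟨⊥, Y.bot_notMem⟩) (supClosed_image f Y)
      (by
        rintro _ ⟨a, ha, y, hy, rfl⟩ _ ⟨c, hc, rfl⟩ hle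
        have h : y ⇨ c ∈ Y.1 := hXY (show f (y ⇨ c) ∈ X.1 by
          rw [f.map_himp]
          exact X.mem_of_le (le_himp_iff.2 hle) ha)
        exact hc (Y.mem_of_le himp_inf_le (Y.inf_mem h hy)))
    have htop : f ⊤ = ⊤ := map_top f.toHeytingHom
    refine ⟨G, fun a ha => h1 _ ⟨a, ha, ⊤, Y.top_mem, by rw [htop, inf_top_eq]⟩, ?_⟩
    ext a
    constructor
    · intro h
      by_contra ha
      exact h2 _ ⟨a, ha, rfl⟩ h
    · intro h
      exact h1 _ ⟨⊤, X.top_mem, a, h, (top_inf_eq _).symm⟩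
  forth X Y Z h a ha b hb := by
    change f (star a b) ∈ X.1
    rw [f.map_star]
    exact h _ ha _ hb
  back_star X W Y Z hW h := by
    obtain ⟨F, G, h1, h2, h3⟩ := PrimeFilter.exists_extend
      (Set.Nonempty.image f ⟨⊤, Y.top_mem⟩) (infClosed_image f Y)
      (Set.Nonempty.image f ⟨⊤, Z.top_mem⟩) (infClosed_image f Z) X (by
        rintro _ ⟨a, ha, rfl⟩ _ ⟨b, hb, rfl⟩
        rw [← f.map_star]
        exact hW (h a ha b hb))
    exact ⟨X, F, G, le_rfl, h3, fun a ha => h1 _ ⟨a, ha, rfl⟩, fun a ha => h2 _ ⟨a, ha, rfl⟩⟩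
  back_wand X W Y Z hXW hZ := by
    obtain ⟨G, H, h⟩ := primeComap_back_wand f X W Y Z hXW hZ
    exact ⟨X, G, H, le_rfl, h⟩
  back_dnaw X W Y Z hXW hZ := by
    obtain ⟨G, H, h, h'⟩ := primeComap_back_wand f X W Y Z hXW (primeComp_comm hZ)
    exact ⟨X, G, H, le_rfl, primeComp_comm h, h'⟩
  unit_iff e := by
    change emp ∈ e.1 ↔ f emp ∈ e.1
    rw [f.map_emp]

/-- If `star a b ∈ H`, the bases `{a}` and `{b}` already compose into `H` and extend to prime
filters. -/
theorem thetaSet_star (a b : A) :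
    thetaSet (star a b) = upStar primeComp (thetaSet a) (thetaSet b) := by
  ext H
  constructor
  · intro h
    obtain ⟨F, G, h1, h2, h3⟩ := PrimeFilter.exists_extend (singleton_nonempty a)
      infClosed_singleton (singleton_nonempty b) infClosed_singleton H (by
        rintro _ rfl _ rfl
        exact h)
    exact ⟨H, F, G, le_rfl, h3, h1 a rfl, h2 b rfl⟩
  · rintro ⟨W, F, G, hW, h, ha, hb⟩
    exact hW (h a ha b hb)

/-- If `wand a b ∉ X`, no product of an element of `X` with `a` lies below `b`, so separation yields
prime filters violating the residual condition at `X`. -/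
theorem thetaSet_wand (a b : A) :
    thetaSet (wand a b) = upWand primeComp (thetaSet a) (thetaSet b) := by
  ext X
  constructor
  · intro h W Y Z hXW hZ ha
    exact Z.mem_of_le (star_wand_le a b) (hZ _ (hXW h) a ha)
  · intro h
    by_contra hab
    obtain ⟨G, H, h1, h2, h3⟩ := exists_primeComp_of_separated X (singleton_nonempty a)
      infClosed_singleton (singleton_nonempty b) supClosed_singleton (by
        rintro x hx _ rfl _ rfl hle
        exact hab (X.mem_of_le ((star_le_iff _ _ _).1 hle) hx))
    exact h2 b rfl (h X G H le_rfl h3 (h1 a rfl))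

theorem upDnaw_primeComp (U V : Set (PrimeFilter A)) :
    upDnaw primeComp U V = upWand primeComp U V := by
  ext X
  exact ⟨fun h W Y Z hW hZ => h W Y Z hW (primeComp_comm hZ),
    fun h W Y Z hW hZ => h W Y Z hW (primeComp_comm hZ)⟩

theorem thetaSet_dnaw (a b : A) :
    thetaSet (wand a b) = upDnaw primeComp (thetaSet a) (thetaSet b) := by
  rw [upDnaw_primeComp, thetaSet_wand]

end PrimeComp

/-! ## Compactness arguments for prime filters -/

/-- Prime filters of a lattice of clopen sets of a compact space are given by points. -/
theorem exists_mem_iff_of_clopen {X L : Type u} [TopologicalSpace X] [CompactSpace X] [Lattice L]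
    [BoundedOrder L] (c : L → Set X) (hc : ∀ U, IsClopen (c U))
    (inf : ∀ U V, c (U ⊓ V) = c U ∩ c V) (sup : ∀ U V, c (U ⊔ V) = c U ∪ c V)
    (le : ∀ U V, c U ⊆ c V → U ≤ V) (G : PrimeFilter L) : ∃ x, ∀ U, x ∈ c U ↔ U ∈ G.1 := by
  by_contra! hG
  -- Each point disagrees with `G` on some element, so it has a neighbourhood missing `c U \ c V`
  -- for some `U ∈ G` and `V ∉ G`. Meets of the `U` and joins of the `V` handle finite unions, and
  -- compactness gives one pair for the whole space: then `U ≤ V`, a contradiction.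
  have key : ∃ U ∈ G.1, ∃ V ∉ G.1, ∀ x ∈ (univ : Set X), ¬ (x ∈ c U ∧ x ∉ c V) := by
    refine isCompact_univ.induction_on
      (p := fun K => ∃ U ∈ G.1, ∃ V ∉ G.1, ∀ x ∈ K, ¬ (x ∈ c U ∧ x ∉ c V))
      ⟨⊤, G.top_mem, ⊥, G.bot_notMem, fun _ h => h.elim⟩ ?_ ?_ ?_
    · rintro s t hst ⟨U, hU, V, hV, h⟩
      exact ⟨U, hU, V, hV, fun x hx => h x (hst hx)⟩
    · rintro s t ⟨U, hU, V, hV, h⟩ ⟨U', hU', V', hV', h'⟩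
      refine ⟨U ⊓ U', G.inf_mem hU hU', V ⊔ V', fun hm => (G.sup_mem_iff.1 hm).elim hV hV', ?_⟩
      rintro x hx ⟨h1, h2⟩
      rw [inf] at h1
      rw [sup] at h2
      rcases hx with hx | hx
      · exact h x hx ⟨h1.1, fun h3 => h2 (Or.inl h3)⟩
      · exact h' x hx ⟨h1.2, fun h3 => h2 (Or.inr h3)⟩
    · intro x _
      obtain ⟨U, h⟩ := hG x
      rw [nhdsWithin_univ]
      rcases h with ⟨h1, h2⟩ | ⟨h1, h2⟩
      · exact ⟨c U, (hc U).isOpen.mem_nhds h1, ⊤, G.top_mem, U, h2, fun y hy h => h.2 hy⟩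
      · exact ⟨(c U)ᶜ, (hc U).compl.isOpen.mem_nhds h1, U, h2, ⊥, G.bot_notMem,
          fun y hy h => hy h.1⟩
  obtain ⟨U, hU, V, hV, h⟩ := key
  refine hV (G.mem_of_le (le U V fun x hx => ?_) hU)
  by_contra hxV
  exact h x trivial ⟨hx, hxV⟩

/-! ### The prime filters of a BI algebra as a BI space -/

section EsakiaTopology

attribute [local instance] esakiaTopology

variable {A : Type u} [HeytingAlgebra A]

theorem isClopen_thetaSet (a : A) : IsClopen (thetaSet a) :=
  ⟨⟨isOpen_generateFrom_of_mem (Or.inr ⟨a, rfl⟩)⟩, isOpen_generateFrom_of_mem (Or.inl ⟨a, rfl⟩)⟩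

/-- An ultrafilter `𝒰` converges to `{a | θ(a) ∈ 𝒰}`. This is a prime filter because `θ` is a
lattice homomorphism and `𝒰` is prime, and convergence need only be tested on the subbase. -/
theorem compactSpace_primeFilter : CompactSpace (PrimeFilter A) := by
  refine ⟨isCompact_iff_ultrafilter_le_nhds.2 fun 𝒰 _ => ?_⟩
  let F : PrimeFilter A := PrimeFilter.ofSet {a | thetaSet a ∈ 𝒰}
    (Filter.mem_of_superset Filter.univ_mem fun G _ => G.top_mem)
    (by
      change thetaSet ⊥ ∉ 𝒰
      rw [thetaSet_bot]
      exact 𝒰.empty_notMem)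
    (fun a ha b hb => by
      change thetaSet (a ⊓ b) ∈ 𝒰
      rw [thetaSet_inf]
      exact Filter.inter_mem ha hb)
    (fun a b hab => by
      change thetaSet (a ⊔ b) ∈ 𝒰 at hab
      rwa [thetaSet_sup, Ultrafilter.union_mem_iff] at hab)
    (fun a b hab ha => Filter.mem_of_superset ha (thetaSet_subset_iff.2 hab))
  refine ⟨F, trivial, ?_⟩
  refine Filter.tendsto_id'.1 (tendsto_nhds_generateFrom_iff.2 ?_)
  rintro _ (⟨a, rfl⟩ | ⟨a, rfl⟩) hF
  · exact hF
  · exact Ultrafilter.compl_mem_iff_notMem.2 hF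

attribute [local instance] compactSpace_primeFilter

instance priestleySpace_primeFilter : PriestleySpace (PrimeFilter A) where
  priestley {F G} h := by
    obtain ⟨a, ha, hb⟩ := Set.not_subset.1 h
    exact ⟨thetaSet a, isClopen_thetaSet a, isUpperSet_thetaSet a, ha, hb⟩

/-- Differences of sets `θ(a)` form a basis of clopen neighbourhoods. -/
theorem exists_thetaSet_diff_subset {U : Set (PrimeFilter A)} (hU : IsOpen U) {F : PrimeFilter A}
    (hF : F ∈ U) : ∃ a b : A, F ∈ thetaSet a \ thetaSet b ∧ thetaSet a \ thetaSet b ⊆ U := by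
  have key : ∃ a ∈ F.1, ∃ b ∉ F.1, ∀ H ∈ Uᶜ, ¬ (a ∈ H.1 ∧ b ∉ H.1) := by
    refine hU.isClosed_compl.isCompact.induction_on
      (p := fun K => ∃ a ∈ F.1, ∃ b ∉ F.1, ∀ H ∈ K, ¬ (a ∈ H.1 ∧ b ∉ H.1))
      ⟨⊤, F.top_mem, ⊥, F.bot_notMem, fun _ h => h.elim⟩ ?_ ?_ ?_
    · rintro s t hst ⟨a, ha, b, hb, h⟩
      exact ⟨a, ha, b, hb, fun x hx => h x (hst hx)⟩
    · rintro s t ⟨a, ha, b, hb, h⟩ ⟨a', ha', b', hb', h'⟩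
      refine ⟨a ⊓ a', F.inf_mem ha ha', b ⊔ b', fun hm => (F.sup_mem_iff.1 hm).elim hb hb', ?_⟩
      rintro H (hH | hH) ⟨h1, h2⟩
      · exact h H hH ⟨(H.inf_mem_iff.1 h1).1, fun h3 => h2 (H.mem_of_le le_sup_left h3)⟩
      · exact h' H hH ⟨(H.inf_mem_iff.1 h1).2, fun h3 => h2 (H.mem_of_le le_sup_right h3)⟩
    · intro H hH
      have hne : ∃ a, ¬ (a ∈ F.1 ↔ a ∈ H.1) := by
        by_contra! hFH
        obtain rfl : F = H := PrimeFilter.ext hFH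
        exact hH hF
      obtain ⟨a, ha⟩ := hne
      by_cases haF : a ∈ F.1
      · exact ⟨(thetaSet a)ᶜ, mem_nhdsWithin_of_mem_nhds
          ((isClopen_thetaSet a).compl.isOpen.mem_nhds fun haH => ha (iff_of_true haF haH)),
          a, haF, ⊥, F.bot_notMem, fun G hG h => hG h.1⟩
      · have haH : a ∈ H.1 := by
          by_contra haH
          exact ha (iff_of_false haF haH)
        exact ⟨thetaSet a, mem_nhdsWithin_of_mem_nhds ((isClopen_thetaSet a).isOpen.mem_nhds haH),
          ⊤, F.top_mem, a, haF, fun G hG h => h.2 hG⟩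
  obtain ⟨a, ha, b, hb, h⟩ := key
  refine ⟨a, b, ⟨ha, hb⟩, fun H hH => ?_⟩
  by_contra hHU
  exact h H hHU hH

/-- Every clopen upwards-closed set of prime filters has the form `θ(a)`. -/
theorem exists_thetaSet_eq {U : Set (PrimeFilter A)} (hU : IsClopen U) (hU' : IsUpperSet U) :
    ∃ a : A, thetaSet a = U := by
  -- Compactness is used twice. Since `U` is an up-set, `F ∈ U` is not below any `H ∉ U`, so
  -- finitely many elements of `F` exclude all of `Uᶜ` and their meet is `b`. Then finitely many
  -- such `θ(b)` cover `U`, and their join is the required element.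
  have nhd : ∀ F ∈ U, ∃ b ∈ F.1, thetaSet b ⊆ U := by
    intro F hF
    have key : ∃ b ∈ F.1, ∀ H ∈ Uᶜ, b ∉ H.1 := by
      refine hU.compl.isClosed.isCompact.induction_on
        (p := fun K => ∃ b ∈ F.1, ∀ H ∈ K, b ∉ H.1)
        ⟨⊤, F.top_mem, fun _ h => h.elim⟩ ?_ ?_ ?_
      · rintro s t hst ⟨b, hb, h⟩
        exact ⟨b, hb, fun x hx => h x (hst hx)⟩
      · rintro s t ⟨b, hb, h⟩ ⟨b', hb', h'⟩
        refine ⟨b ⊓ b', F.inf_mem hb hb', ?_⟩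
        rintro H (hH | hH) h1
        · exact h H hH (H.inf_mem_iff.1 h1).1
        · exact h' H hH (H.inf_mem_iff.1 h1).2
      · intro H hH
        have hFH : ¬ F ≤ H := fun hle => hH (hU' hle hF)
        obtain ⟨a, ha, hb⟩ := Set.not_subset.1 hFH
        exact ⟨(thetaSet a)ᶜ,
          mem_nhdsWithin_of_mem_nhds ((isClopen_thetaSet a).compl.isOpen.mem_nhds hb),
          a, ha, fun G hG => hG⟩
    obtain ⟨b, hb, h⟩ := key
    refine ⟨b, hb, fun H hH => ?_⟩
    by_contra hHU
    exact h H hHU hH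
  have key : ∃ a : A, U ⊆ thetaSet a ∧ thetaSet a ⊆ U := by
    refine hU.isClosed.isCompact.induction_on (p := fun K => ∃ a, K ⊆ thetaSet a ∧ thetaSet a ⊆ U)
      ⟨⊥, empty_subset _, by rw [thetaSet_bot]; exact empty_subset _⟩ ?_ ?_ ?_
    · rintro s t hst ⟨a, h, h'⟩
      exact ⟨a, hst.trans h, h'⟩
    · rintro s t ⟨a, h1, h2⟩ ⟨b, h3, h4⟩
      refine ⟨a ⊔ b, ?_⟩
      rw [thetaSet_sup]
      exact ⟨union_subset_union h1 h3, union_subset h2 h4⟩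
    · intro F hF
      obtain ⟨b, hb, h⟩ := nhd F hF
      exact ⟨thetaSet b, mem_nhdsWithin_of_mem_nhds ((isClopen_thetaSet b).isOpen.mem_nhds hb),
        b, subset_rfl, h⟩
  exact key.imp fun a h => h.2.antisymm h.1

/-- By `thetaSet_himp`, the down-closure of `θ(a) \ θ(b)` is the complement of `θ(a ⇨ b)`, hence
clopen. Finitely many such differences contained in `U` cover it, and the union of their
down-closures is the down-closure of `U`. -/
theorem isClopen_lowerClosure {U : Set (PrimeFilter A)} (hU : IsClopen U) :
    IsClopen (lowerClosure U : Set (PrimeFilter A)) := by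
  have key : ∃ W : Set (PrimeFilter A), IsClopen W ∧ IsLowerSet W ∧ U ⊆ W ∧
      W ⊆ lowerClosure U := by
    refine hU.isClosed.isCompact.induction_on
      (p := fun K => ∃ W : Set (PrimeFilter A), IsClopen W ∧ IsLowerSet W ∧ K ⊆ W ∧
        W ⊆ lowerClosure U)
      ⟨∅, isClopen_empty, isLowerSet_empty, subset_rfl, empty_subset _⟩ ?_ ?_ ?_
    · rintro s t hst ⟨W, h1, h2, h3, h4⟩
      exact ⟨W, h1, h2, hst.trans h3, h4⟩
    · rintro s t ⟨W, h1, h2, h3, h4⟩ ⟨W', h1', h2', h3', h4'⟩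
      exact ⟨W ∪ W', h1.union h1', h2.union h2', union_subset_union h3 h3', union_subset h4 h4'⟩
    · intro F hF
      obtain ⟨a, b, hFab, hab⟩ := exists_thetaSet_diff_subset hU.isOpen hF
      refine ⟨thetaSet a \ thetaSet b, mem_nhdsWithin_of_mem_nhds
        (((isClopen_thetaSet a).diff (isClopen_thetaSet b)).isOpen.mem_nhds hFab),
        (thetaSet (a ⇨ b))ᶜ, (isClopen_thetaSet _).compl, (isUpperSet_thetaSet _).compl, ?_, ?_⟩
      · intro G hG h
        exact hG.2 (G.mem_of_le himp_inf_le (G.inf_mem h hG.1))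
      · intro G hG
        rw [thetaSet_himp] at hG
        simp only [mem_compl_iff, upImp, mem_ofPred_eq, not_forall] at hG
        obtain ⟨H, hGH, h1, h2⟩ := hG
        exact ⟨H, hab ⟨h1, h2⟩, hGH⟩
  obtain ⟨W, h1, h2, h3, h4⟩ := key
  rwa [h4.antisymm (lowerClosure_min h3 h2)] at h1

theorem isEsakiaSpace_primeFilter : IsEsakiaSpace (PrimeFilter A) where
  compact := compactSpace_primeFilter
  priestley := priestleySpace_primeFilter
  lower_clopen _ hU := isClopen_lowerClosure hU

variable [BIStructure A]

/-- Every clopen up-set is some `θ(a)`, so closure under the operations reduces to the formulas for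
`θ` of `star` and `wand`. A pair `a ∈ F`, `b ∈ G` with `star a b ∉ H` is itself the separation
witness. -/
theorem isILGLSpace_primeFilter : IsILGLSpace (X := PrimeFilter A) primeComp where
  esakia := isEsakiaSpace_primeFilter
  star_clopen U V := by
    obtain ⟨a, ha⟩ := exists_thetaSet_eq U.isClopen U.upper
    obtain ⟨b, hb⟩ := exists_thetaSet_eq V.isClopen V.upper
    rw [← ha, ← hb, ← thetaSet_star]
    exact ⟨isClopen_thetaSet _, isUpperSet_thetaSet _⟩
  wand_clopen U V := by
    obtain ⟨a, ha⟩ := exists_thetaSet_eq U.isClopen U.upper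
    obtain ⟨b, hb⟩ := exists_thetaSet_eq V.isClopen V.upper
    rw [← ha, ← hb, ← thetaSet_wand]
    exact ⟨isClopen_thetaSet _, isUpperSet_thetaSet _⟩
  dnaw_clopen U V := by
    obtain ⟨a, ha⟩ := exists_thetaSet_eq U.isClopen U.upper
    obtain ⟨b, hb⟩ := exists_thetaSet_eq V.isClopen V.upper
    rw [← ha, ← hb, ← thetaSet_dnaw]
    exact ⟨isClopen_thetaSet _, isUpperSet_thetaSet _⟩
  separation H F G h := by
    simp only [primeComp, mem_ofPred_eq, not_forall] at h
    obtain ⟨a, ha, b, hb, hab⟩ := h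
    refine ⟨⟨⟨thetaSet a, isClopen_thetaSet a⟩, isUpperSet_thetaSet a⟩,
      ⟨⟨thetaSet b, isClopen_thetaSet b⟩, isUpperSet_thetaSet b⟩, ha, hb, ?_⟩
    change H ∉ upStar primeComp (thetaSet a) (thetaSet b)
    rw [← thetaSet_star]
    exact hab

theorem isBISpace_primeFilter : IsBISpace (X := PrimeFilter A) primeComp (primeUnit A) where
  ilgl := isILGLSpace_primeFilter
  frame := isBIFrame_primeComp
  unit_clopen := isClopen_thetaSet emp

theorem continuous_primeComap {B : Type u} [HeytingAlgebra B] [BIStructure B] (f : BIHom A B) :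
    Continuous (primeComap f) := by
  refine continuous_generateFrom_iff.2 ?_
  rintro _ (⟨a, rfl⟩ | ⟨a, rfl⟩)
  · exact (isClopen_thetaSet (f a)).isOpen
  · exact (isClopen_thetaSet (f a)).compl.isOpen

end EsakiaTopology

theorem prBIWellDefined : PrBIWellDefined.{u} where
  space _ := isBISpace_primeFilter
  continuous _ _ f := continuous_primeComap f
  morphism _ _ f := isBIMorphism_primeComap f

/-! ## Frames with a discrete order -/

section Discrete

variable {X Y : Type u}

theorem upStar_eq_clStar [Preorder X] (hX : ∀ x y : X, x ≤ y → x = y) (c : X → X → Set X)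
    (A B : Set X) : upStar c A B = clStar c A B := by
  ext x
  constructor
  · rintro ⟨w, y, z, hw, h, hy, hz⟩
    obtain rfl := hX _ _ hw
    exact ⟨y, z, hy, hz, h⟩
  · rintro ⟨y, z, hy, hz, h⟩
    exact ⟨x, y, z, le_rfl, h, hy, hz⟩

theorem upWand_eq_clWand [Preorder X] (hX : ∀ x y : X, x ≤ y → x = y) (c : X → X → Set X)
    (A B : Set X) : upWand c A B = clWand c A B := by
  ext x
  refine ⟨fun h y z => h x y z le_rfl, fun h w y z hw => ?_⟩
  obtain rfl := hX _ _ hw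
  exact h y z

theorem upDnaw_eq_clDnaw [Preorder X] (hX : ∀ x y : X, x ≤ y → x = y) (c : X → X → Set X)
    (A B : Set X) : upDnaw c A B = clDnaw c A B := by
  ext x
  refine ⟨fun h y z => h x y z le_rfl, fun h w y z hw => ?_⟩
  obtain rfl := hX _ _ hw
  exact h y z

theorem IsBIFrame.isBBIFrame [Preorder X] (hX : ∀ x y : X, x ≤ y → x = y) {c : X → X → Set X}
    {E : Set X} (h : IsBIFrame c E) : IsBBIFrame c E where
  comm := h.comm
  unit_exists := h.unit_exists
  coherence x y e hx he := hX _ _ (h.coherence x y e he hx)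
  assoc x y z t w ht hw := by
    obtain ⟨s, s', w', h1, h2, h3, h4⟩ := h.assoc x y z t t w le_rfl ht hw
    obtain rfl := hX _ _ h1
    obtain rfl := hX _ _ h3
    exact ⟨s, h2, h4⟩

theorem IsBIMorphism.isBBIMorphism [Preorder X] [Preorder Y] (hX : ∀ x y : X, x ≤ y → x = y)
    (hY : ∀ x y : Y, x ≤ y → x = y) {c : X → X → Set X} {E : Set X} {d : Y → Y → Set Y}
    {E' : Set Y} {g : X → Y} (h : IsBIMorphism c E d E' g) : IsBBIMorphism c E d E' g where
  forth := h.forth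
  back_star x y' z' h' := by
    obtain ⟨w, y, z, h1, h2, h3, h4⟩ := h.back_star x _ y' z' le_rfl h'
    obtain rfl := hX _ _ h1
    exact ⟨y, z, h2, (hY _ _ h3).symm, (hY _ _ h4).symm⟩
  back_wand x y' z' h' := by
    obtain ⟨w, y, z, h1, h2, h3, h4⟩ := h.back_wand x _ y' z' le_rfl h'
    obtain rfl := hX _ _ h1
    exact ⟨y, z, h2, (hY _ _ h3).symm, hY _ _ h4⟩
  back_dnaw x y' z' h' := by
    obtain ⟨w, y, z, h1, h2, h3, h4⟩ := h.back_dnaw x _ y' z' le_rfl h'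
    obtain rfl := hX _ _ h1
    exact ⟨y, z, h2, (hY _ _ h3).symm, hY _ _ h4⟩
  unit_iff := h.unit_iff

theorem IsBISpace.isBBISpace [TopologicalSpace X] [PartialOrder X] (hX : ∀ x y : X, x ≤ y → x = y)
    {c : X → X → Set X} {E : Set X} (h : IsBISpace c E) : IsBBISpace c E where
  lgl :=
    -- For a discrete order every set is an up-set, so the BI axioms apply to arbitrary clopen sets.
    have up (U : Set X) : IsUpperSet U := fun x y hxy hx => hX x y hxy ▸ hx
    { stone :=
        have := h.ilgl.esakia.priestley
        ⟨h.ilgl.esakia.compact, inferInstance, inferInstance⟩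
      star_clopen := fun A B => by
        rw [← upStar_eq_clStar hX]
        exact (h.ilgl.star_clopen ⟨A, up _⟩ ⟨B, up _⟩).1
      wand_clopen := fun A B => by
        rw [← upWand_eq_clWand hX]
        exact (h.ilgl.wand_clopen ⟨A, up _⟩ ⟨B, up _⟩).1
      dnaw_clopen := fun A B => by
        rw [← upDnaw_eq_clDnaw hX]
        exact (h.ilgl.dnaw_clopen ⟨A, up _⟩ ⟨B, up _⟩).1
      separation := fun x y z hx => by
        obtain ⟨A, B, h1, h2, h3⟩ := h.ilgl.separation x y z hx
        rw [upStar_eq_clStar hX] at h3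
        exact ⟨A.toClopens, B.toClopens, h1, h2, h3⟩ }
  frame := h.frame.isBBIFrame hX
  unit_clopen := h.unit_clopen

/-- An element `a` of `G` outside `F` would have `aᶜ ∈ F ⊆ G`, contradicting properness of `G`. -/
theorem PrimeFilter.eq_of_le {A : Type u} [BooleanAlgebra A] (F G : PrimeFilter A) (h : F ≤ G) :
    F = G := by
  ext a
  refine ⟨fun ha => h ha, fun ha => ?_⟩
  by_contra haF
  have h1 : F ∈ thetaSet aᶜ := by
    rw [← compl_thetaSet]
    exact haF
  have h2 : G ∈ (thetaSet a)ᶜ := by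
    rw [compl_thetaSet]
    exact h h1
  exact h2 ha

theorem stoneTopology_eq_esakiaTopology (A : Type u) [BooleanAlgebra A] :
    stoneTopology A = esakiaTopology A := by
  refine congrArg generateFrom (Set.ext fun S => ⟨Or.inl, ?_⟩)
  rintro (h | ⟨a, rfl⟩)
  · exact h
  · exact ⟨aᶜ, compl_thetaSet a⟩

end Discrete

theorem prBBIWellDefined : PrBBIWellDefined.{u} where
  space A := by
    rw [stoneTopology_eq_esakiaTopology]
    let := esakiaTopology A
    exact isBISpace_primeFilter.isBBISpace PrimeFilter.eq_of_le
  continuous A B f := by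
    rw [stoneTopology_eq_esakiaTopology, stoneTopology_eq_esakiaTopology]
    exact prBIWellDefined.continuous ⟨A⟩ ⟨B⟩ f
  morphism A B f :=
    (isBIMorphism_primeComap f).isBBIMorphism PrimeFilter.eq_of_le PrimeFilter.eq_of_le

/-! ## The natural isomorphism `θ` -/

/-- A bijective homomorphism is an isomorphism of BI algebras. -/
noncomputable def BIAlg.isoOfBijective {A B : BIAlg.{u}} (f : BIHom A B)
    (hf : Function.Bijective f) : A ≅ B where
  hom := f
  inv := f.inverse hf
  hom_inv_id := BIHom.ext (f.inverse_apply_apply hf)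
  inv_hom_id := BIHom.ext (f.apply_inverse_apply hf)

/-- A bijective homomorphism is an isomorphism of BBI algebras. -/
noncomputable def BBIAlg.isoOfBijective {A B : BBIAlg.{u}} (f : BIHom A B)
    (hf : Function.Bijective f) : A ≅ B where
  hom := f
  inv := f.inverse hf
  hom_inv_id := BIHom.ext (f.inverse_apply_apply hf)
  inv_hom_id := BIHom.ext (f.apply_inverse_apply hf)

/-- `θ` as a homomorphism of BI algebras. -/
def thetaBIHom (h : PrBIWellDefined.{u}) (A : BIAlg.{u}) :
    BIHom A (ClopenUpperSet ((prBI h).obj A).unop) where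
  toFun := thetaBI h A
  map_sup' a b := ClopenUpperSet.ext (thetaSet_sup a b)
  map_inf' a b := ClopenUpperSet.ext (thetaSet_inf a b)
  map_bot' := ClopenUpperSet.ext thetaSet_bot
  map_himp' a b := ClopenUpperSet.ext (thetaSet_himp a b)
  map_star' a b := ClopenUpperSet.ext (thetaSet_star a b)
  map_wand' a b := ClopenUpperSet.ext (thetaSet_wand a b)
  map_emp' := rfl

/-- Injectivity comes from the prime ideal theorem, surjectivity from compactness. -/
theorem thetaBIHom_bijective (h : PrBIWellDefined.{u}) (A : BIAlg.{u}) :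
    Function.Bijective (thetaBIHom h A) := by
  refine ⟨fun a b hab => thetaSet_injective (congrArg (fun U => (SetLike.coe U : Set _)) hab),
    fun U => ?_⟩
  obtain ⟨a, ha⟩ := exists_thetaSet_eq (A := A) U.isClopen U.upper
  exact ⟨a, ClopenUpperSet.ext ha⟩

/-- The natural isomorphism `θ` for BI algebras. -/
noncomputable def thetaBIIso (h : PrBIWellDefined.{u}) : 𝟭 BIAlg.{u} ≅ prBI h ⋙ clopBI :=
  NatIso.ofComponents
    (fun A => BIAlg.isoOfBijective (B := (prBI h ⋙ clopBI).obj A) (thetaBIHom h A)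
      (thetaBIHom_bijective h A))
    -- Naturality is definitional: `F ∈ θ(f a)` and `f⁻¹(F) ∈ θ(a)` both unfold to `f a ∈ F`.
    (fun _ => BIHom.ext fun _ => rfl)

/-- `θ` as a homomorphism of BBI algebras. -/
def thetaBBIHom (h : PrBBIWellDefined.{u}) (A : BBIAlg.{u}) :
    BIHom A (Clopens ((prBBI h).obj A).unop) where
  toFun := thetaBBI h A
  map_sup' a b := Clopens.ext (thetaSet_sup a b)
  map_inf' a b := Clopens.ext (thetaSet_inf a b)
  map_bot' := Clopens.ext thetaSet_bot
  map_himp' a b := Clopens.ext <| by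
    change thetaSet (a ⇨ b) = thetaSet a ⇨ thetaSet b
    rw [himp_eq, himp_eq, thetaSet_sup, compl_thetaSet]
    rfl
  map_star' a b := Clopens.ext <|
    (thetaSet_star a b).trans (upStar_eq_clStar PrimeFilter.eq_of_le _ _ _)
  map_wand' a b := Clopens.ext <|
    (thetaSet_wand a b).trans (upWand_eq_clWand PrimeFilter.eq_of_le _ _ _)
  map_emp' := rfl

theorem thetaBBIHom_bijective (h : PrBBIWellDefined.{u}) (A : BBIAlg.{u}) :
    Function.Bijective (thetaBBIHom h A) := by
  refine ⟨fun a b hab => thetaSet_injective (congrArg (fun U => (SetLike.coe U : Set _)) hab),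
    fun U => ?_⟩
  have hU : @IsClopen _ (stoneTopology A) U.carrier := U.isClopen
  rw [stoneTopology_eq_esakiaTopology] at hU
  -- Prime filters of a Boolean algebra are ordered discretely, so the clopen set is automatically
  -- an up-set.
  obtain ⟨a, ha⟩ := exists_thetaSet_eq (A := A) hU fun F G hFG hF =>
    PrimeFilter.eq_of_le F G hFG ▸ hF
  exact ⟨a, Clopens.ext ha⟩

/-- The natural isomorphism `θ` for BBI algebras. -/
noncomputable def thetaBBIIso (h : PrBBIWellDefined.{u}) : 𝟭 BBIAlg.{u} ≅ prBBI h ⋙ clopBBI :=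
  NatIso.ofComponents
    (fun A => BBIAlg.isoOfBijective (B := (prBBI h ⋙ clopBBI).obj A) (thetaBBIHom h A)
      (thetaBBIHom_bijective h A))
    (fun _ => BIHom.ext fun _ => rfl)

/-! ## Isomorphisms of frames and spaces -/

section FrameIso

variable {X Y : Type u} {c : X → X → Set X} {E : Set X} {d : Y → Y → Set Y} {E' : Set Y}

/-- With all structure reflected, preimages under `e` witness every back condition. The hypotheses
are equivalences so that they pass to the inverse map. -/
theorem isBIMorphism_of_equiv [Preorder X] [Preorder Y] (e : X ≃ Y)
    (hle : ∀ x y, x ≤ y ↔ e x ≤ e y) (hc : ∀ x y z, x ∈ c y z ↔ e x ∈ d (e y) (e z))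
    (hE : ∀ x, x ∈ E ↔ e x ∈ E') : IsBIMorphism c E d E' e where
  mono x y := (hle x y).1
  back_le x y' h := by
    obtain ⟨y, rfl⟩ := e.surjective y'
    exact ⟨y, (hle _ _).2 h, rfl⟩
  forth x y z := (hc x y z).1
  back_star x w' y' z' h h' := by
    obtain ⟨w, rfl⟩ := e.surjective w'
    obtain ⟨y, rfl⟩ := e.surjective y'
    obtain ⟨z, rfl⟩ := e.surjective z'
    exact ⟨w, y, z, (hle _ _).2 h, (hc _ _ _).2 h', le_rfl, le_rfl⟩
  back_wand x w' y' z' h h' := by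
    obtain ⟨w, rfl⟩ := e.surjective w'
    obtain ⟨y, rfl⟩ := e.surjective y'
    obtain ⟨z, rfl⟩ := e.surjective z'
    exact ⟨w, y, z, (hle _ _).2 h, (hc _ _ _).2 h', le_rfl, le_rfl⟩
  back_dnaw x w' y' z' h h' := by
    obtain ⟨w, rfl⟩ := e.surjective w'
    obtain ⟨y, rfl⟩ := e.surjective y'
    obtain ⟨z, rfl⟩ := e.surjective z'
    exact ⟨w, y, z, (hle _ _).2 h, (hc _ _ _).2 h', le_rfl, le_rfl⟩
  unit_iff := hE

theorem isBBIMorphism_of_equiv (e : X ≃ Y) (hc : ∀ x y z, x ∈ c y z ↔ e x ∈ d (e y) (e z))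
    (hE : ∀ x, x ∈ E ↔ e x ∈ E') : IsBBIMorphism c E d E' e where
  forth x y z := (hc x y z).1
  back_star x y' z' h := by
    obtain ⟨y, rfl⟩ := e.surjective y'
    obtain ⟨z, rfl⟩ := e.surjective z'
    exact ⟨y, z, (hc _ _ _).2 h, rfl, rfl⟩
  back_wand x y' z' h := by
    obtain ⟨y, rfl⟩ := e.surjective y'
    obtain ⟨z, rfl⟩ := e.surjective z'
    exact ⟨y, z, (hc _ _ _).2 h, rfl, rfl⟩
  back_dnaw x y' z' h := by
    obtain ⟨y, rfl⟩ := e.surjective y'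
    obtain ⟨z, rfl⟩ := e.surjective z'
    exact ⟨y, z, (hc _ _ _).2 h, rfl, rfl⟩
  unit_iff := hE

end FrameIso

theorem BISp.t2Space (X : BISp.{u}) : T2Space X :=
  have := X.isBISpace.ilgl.esakia.priestley
  inferInstance

/-- A continuous bijection preserving and reflecting the structure is an isomorphism of
BI spaces. -/
noncomputable def BISp.isoOfBijective {X Y : BISp.{u}} (g : X → Y) (hg : Function.Bijective g)
    (hcont : Continuous g) (hle : ∀ x y, x ≤ y ↔ g x ≤ g y)
    (hc : ∀ x y z, x ∈ X.comp y z ↔ g x ∈ Y.comp (g y) (g z))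
    (hE : ∀ x, x ∈ X.unit ↔ g x ∈ Y.unit) : X ≅ Y :=
  let e := Equiv.ofBijective g hg
  have he (y : Y) : g (e.symm y) = y := e.apply_symm_apply y
  { hom := BISp.Map.mk g hcont (isBIMorphism_of_equiv e hle hc hE)
    inv := BISp.Map.mk e.symm
      (have := X.isBISpace.ilgl.esakia.compact
        have := Y.t2Space
        (show Continuous e from hcont).continuous_symm_of_equiv_compact_to_t2)
      (isBIMorphism_of_equiv e.symm (fun x y => by rw [hle, he, he])
        (fun x y z => by rw [hc, he, he, he]) (fun x => by rw [hE, he]))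
    hom_inv_id := DFunLike.ext (F := BISp.Map X X) _ _ e.symm_apply_apply
    inv_hom_id := DFunLike.ext (F := BISp.Map Y Y) _ _ e.apply_symm_apply }

/-- A continuous bijection preserving and reflecting the structure is an isomorphism of
BBI spaces. -/
noncomputable def BBISp.isoOfBijective {X Y : BBISp.{u}} (g : X → Y) (hg : Function.Bijective g)
    (hcont : Continuous g) (hc : ∀ x y z, x ∈ X.comp y z ↔ g x ∈ Y.comp (g y) (g z))
    (hE : ∀ x, x ∈ X.unit ↔ g x ∈ Y.unit) : X ≅ Y :=
  let e := Equiv.ofBijective g hg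
  have he (y : Y) : g (e.symm y) = y := e.apply_symm_apply y
  { hom := BBISp.Map.mk g hcont (isBBIMorphism_of_equiv e hc hE)
    inv := BBISp.Map.mk e.symm
      (have := X.isBBISpace.lgl.stone.compact
        have := Y.isBBISpace.lgl.stone.hausdorff
        (show Continuous e from hcont).continuous_symm_of_equiv_compact_to_t2)
      (isBBIMorphism_of_equiv e.symm (fun x y z => by rw [hc, he, he, he])
        (fun x => by rw [hE, he]))
    hom_inv_id := DFunLike.ext (F := BBISp.Map X X) _ _ e.symm_apply_apply
    inv_hom_id := DFunLike.ext (F := BBISp.Map Y Y) _ _ e.apply_symm_apply }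

/-! ## The natural isomorphism `η` -/

section EtaBI

variable (X : BISp.{u})

/-- Reflection of the order is Priestley separation; it also gives injectivity of `η` by
antisymmetry. -/
theorem etaBI_le_iff (x y : X) : x ≤ y ↔ etaBI X x ≤ etaBI X y := by
  refine ⟨fun h U hU => U.upper h hU, fun h => ?_⟩
  by_contra hxy
  obtain ⟨U, h1, h2, h3, h4⟩ := X.isBISpace.ilgl.esakia.priestley.priestley hxy
  exact h4 (h (show (⟨⟨U, h1⟩, h2⟩ : ClopenUpperSet X) ∈ (etaBI X x).1 from h3))

theorem etaBI_bijective : Function.Bijective (etaBI X) := by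
  refine ⟨fun x y h => le_antisymm ((etaBI_le_iff X x y).2 h.le) ((etaBI_le_iff X y x).2 h.ge),
    fun G => ?_⟩
  have := X.isBISpace.ilgl.esakia.compact
  obtain ⟨x, hx⟩ := exists_mem_iff_of_clopen (L := ClopenUpperSet X) (fun U => (U : Set X))
    (fun U => U.isClopen) (fun _ _ => rfl) (fun _ _ => rfl) (fun _ _ h => h) G
  exact ⟨x, PrimeFilter.ext hx⟩

/-- The preimage of `θ(U)` under `η` is `U` itself. -/
theorem continuous_etaBI :
    @Continuous _ _ _ (esakiaTopology (ClopenUpperSet X)) (etaBI X) := by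
  refine continuous_generateFrom_iff.2 ?_
  rintro _ (⟨U, rfl⟩ | ⟨U, rfl⟩)
  · exact U.isClopen.isOpen
  · exact U.isClopen.compl.isOpen

/-- The converse direction is exactly the separation axiom for composition, the only place where
that axiom enters the BI case of `η`. -/
theorem etaBI_mem_primeComp_iff (x y z : X) :
    x ∈ X.comp y z ↔ etaBI X x ∈ primeComp (etaBI X y) (etaBI X z) := by
  refine ⟨fun h U hU V hV => ⟨x, y, z, le_rfl, h, hU, hV⟩, fun h => ?_⟩
  by_contra hx
  obtain ⟨U, V, hU, hV, hUV⟩ := X.isBISpace.ilgl.separation x y z hx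
  exact hUV (h U hU V hV)

/-- `η` as an isomorphism of BI spaces. -/
noncomputable def etaBIIsoApp (h : PrBIWellDefined.{u}) :
    X ≅ ((prBI h).obj (clopBI.obj (op X))).unop :=
  BISp.isoOfBijective (Y := ((prBI h).obj (clopBI.obj (op X))).unop) (etaBI X)
    (etaBI_bijective X) (continuous_etaBI X) (etaBI_le_iff X) (etaBI_mem_primeComp_iff X)
    (fun _ => Iff.rfl)

end EtaBI

/-- The natural isomorphism `η` for BI spaces. -/
noncomputable def etaBIIso (h : PrBIWellDefined.{u}) : clopBI ⋙ prBI h ≅ 𝟭 BISp.{u}ᵒᵖ :=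
  NatIso.ofComponents (fun X => (etaBIIsoApp X.unop h).op) (fun _ => rfl)

section EtaBBI

variable (X : BBISp.{u})

/-- Without an order, injectivity rests on the separation of distinct points by clopen sets in a
Stone space. -/
theorem etaBBI_bijective : Function.Bijective (etaBBI X) := by
  have S := X.isBBISpace.lgl.stone
  have := S.compact
  have := S.hausdorff
  have := S.totallyDisconnected
  refine ⟨fun x y h => ?_, fun G => ?_⟩
  · by_contra hxy
    obtain ⟨U, hU, hx, hy⟩ := exists_isClopen_of_totally_separated hxy
    have hm : (⟨U, hU⟩ : Clopens X) ∈ (etaBBI X x).1 := hx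
    rw [h] at hm
    exact hy hm
  · obtain ⟨x, hx⟩ := exists_mem_iff_of_clopen (L := Clopens X) (fun U => (U : Set X))
      (fun U => U.isClopen) (fun _ _ => rfl) (fun _ _ => rfl) (fun _ _ h => h) G
    exact ⟨x, PrimeFilter.ext hx⟩

theorem continuous_etaBBI : @Continuous _ _ _ (stoneTopology (Clopens X)) (etaBBI X) := by
  refine continuous_generateFrom_iff.2 ?_
  rintro _ ⟨U, rfl⟩
  exact U.isClopen.isOpen

theorem etaBBI_mem_primeComp_iff (x y z : X) :
    x ∈ X.comp y z ↔ etaBBI X x ∈ primeComp (etaBBI X y) (etaBBI X z) := by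
  refine ⟨fun h U hU V hV => ⟨y, z, hU, hV, h⟩, fun h => ?_⟩
  by_contra hx
  obtain ⟨U, V, hU, hV, hUV⟩ := X.isBBISpace.lgl.separation x y z hx
  exact hUV (h U hU V hV)

/-- `η` as an isomorphism of BBI spaces. -/
noncomputable def etaBBIIsoApp (h : PrBBIWellDefined.{u}) :
    X ≅ ((prBBI h).obj (clopBBI.obj (op X))).unop :=
  BBISp.isoOfBijective (Y := ((prBBI h).obj (clopBBI.obj (op X))).unop) (etaBBI X)
    (etaBBI_bijective X) (continuous_etaBBI X) (etaBBI_mem_primeComp_iff X) (fun _ => Iff.rfl)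

end EtaBBI

/-- The natural isomorphism `η` for BBI spaces. -/
noncomputable def etaBBIIso (h : PrBBIWellDefined.{u}) : clopBBI ⋙ prBBI h ≅ 𝟭 BBISp.{u}ᵒᵖ :=
  NatIso.ofComponents (fun X => (etaBBIIsoApp X.unop h).op) (fun _ => rfl)

end BunchedDuality

theorem mainTheorem4 :
    (∃ (h : PrBIWellDefined.{u})
        (θ : 𝟭 BIAlg.{u} ≅ prBI h ⋙ clopBI)
        (η : clopBI ⋙ prBI h ≅ 𝟭 BISp.{u}ᵒᵖ),
      (∀ (A : BIAlg.{u}) (a : A),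
        θ.hom.app A a = thetaBI h A a) ∧
      (∀ (X : BISp.{u}) (x : X),
        (η.hom.app (op X)).unop x = etaBI X x) ∧
      (∀ A : BIAlg.{u},
        (prBI h).map (θ.hom.app A) ≫ η.hom.app ((prBI h).obj A)
          = 𝟙 ((prBI h).obj A))) ∧
    (∃ (h : PrBBIWellDefined.{u})
        (θ : 𝟭 BBIAlg.{u} ≅ prBBI h ⋙ clopBBI)
        (η : clopBBI ⋙ prBBI h ≅ 𝟭 BBISp.{u}ᵒᵖ),
      (∀ (A : BBIAlg.{u}) (a : A),
        θ.hom.app A a = thetaBBI h A a) ∧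
      (∀ (X : BBISp.{u}) (x : X),
        (η.hom.app (op X)).unop x = etaBBI X x) ∧
      (∀ A : BBIAlg.{u},
        (prBBI h).map (θ.hom.app A) ≫ η.hom.app ((prBBI h).obj A)
          = 𝟙 ((prBBI h).obj A))) := by
  -- The triangle identity is definitional: pulling `η(F) = {U | F ∈ U}` back along `θ` gives `{a |
  -- F ∈ θ(a)}`, which is `F`.
  exact ⟨⟨prBIWellDefined, thetaBIIso _, etaBIIso _, fun _ _ => rfl, fun _ _ => rfl,
      fun _ => rfl⟩,
    ⟨prBBIWellDefined, thetaBBIIso _, etaBBIIso _, fun _ _ => rfl, fun _ _ => rfl,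
      fun _ => rfl⟩⟩
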